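/- Let $k$ be a field of characteristic zero and let $m,r$ be integers with $1\le r\le m-2$. Let $\mathcal S(r)$ be the $m\times m$ symmetric matrix whose $(i,j)$ entry and $(j,i)$ entry, for $1\le i\le j\le m$, are both equal to a variable $x_{i,j}$ if $i+j\le 2m-r$ and to $0$ if $i+j>2m-r$. Let $R=k[x_{i,j} : 1\le i\le j\le m,\ i+j\le 2m-r]$ be the polynomial ring in the nonzero entries of $\mathcal S(r)$, let $f=\det\mathcal S(r)\in R$, and let $J\subset R$ be the ideal generated by the partial derivatives $\partial f/\partial x_{i,j}$ of $f$ with respect to all the variables of $R$. Then: (a) $f$ is irreducible in $R$. (b) The codimension (height) of $J$ is $2$ if $m-r=2$, and $3$ otherwise. Moreover, $R/(f)$ is a normal domain (an integral domain that is integrally closed in its field of fractions) if and only if $m-r\ge 3$. -/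

import Mathlib

/-- The variables `x_{i,j}` of the matrix `S(r)` of order `m`: one for each pair `i ≤ j` whose
entry is not replaced by zero. In one-based indices the entry at `(i, j)` is kept exactly when
`i + j ≤ 2m - r`; rows and columns are indexed here by `Fin m` (zero-based), so the condition
reads `(i + 1) + (j + 1) + r ≤ 2m`. -/
abbrev SparseVar (m r : ℕ) : Type :=
  {p : Fin m × Fin m // p.1 ≤ p.2 ∧ ((p.1 : ℕ) + 1) + ((p.2 : ℕ) + 1) + r ≤ 2 * m}

theorem sparseVar_mem {m r : ℕ} {i j : Fin m}
    (h : ((i : ℕ) + 1) + ((j : ℕ) + 1) + r ≤ 2 * m) :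
    min i j ≤ max i j ∧
      (((min i j : Fin m) : ℕ) + 1) + (((max i j : Fin m) : ℕ) + 1) + r ≤ 2 * m := by
  refine ⟨min_le_max, ?_⟩
  rcases le_total i j with hij | hij
  · rw [min_eq_left hij, max_eq_right hij]; exact h
  · rw [min_eq_right hij, max_eq_left hij]; omega

/-- The sparse degeneration `S(r)` of the generic symmetric `m × m` matrix: the symmetric matrix
of variables in which the triangle with `r` zeros along each side, in the lower right corner,
has been replaced by zeros. -/
noncomputable def sparseMatrix (k : Type*) [Field k] (m r : ℕ) :
    Matrix (Fin m) (Fin m) (MvPolynomial (SparseVar m r) k) :=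
  Matrix.of fun i j =>
    if h : ((i : ℕ) + 1) + ((j : ℕ) + 1) + r ≤ 2 * m then
      MvPolynomial.X ⟨(min i j, max i j), sparseVar_mem h⟩
    else 0

/-- The determinant `f = det S(r)`. -/
noncomputable def sparseDet (k : Type*) [Field k] (m r : ℕ) :
    MvPolynomial (SparseVar m r) k :=
  (sparseMatrix k m r).det

/-- The gradient ideal of a polynomial: the ideal generated by its partial derivatives. -/
noncomputable def gradientIdeal {k σ : Type*} [Field k] (f : MvPolynomial σ k) :
    Ideal (MvPolynomial σ k) :=
  Ideal.span (Set.range fun v : σ => MvPolynomial.pderiv v f)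

/-! Put `s = m - r`, so that in one-based indices the entry at `(i, j)` survives exactly when `i + j
≤ m + s`. The argument is an induction on the order `m` with `s` fixed.

If `s < m`, the last row meets only the first `s` columns. For a variable `w` in the last row and
column `v`, the block on rows and columns `v`, `last` has determinant `-w²`, because the corner
entry is zero. After inverting `w`, a Schur complement and a change of coordinates turn `f` into a
unit times the determinant of the staircase matrix of order `m - 2` with the same `s`
(`IsStaircase.pivotReduction_two`). If `s ≥ m`, the matrix is generic symmetric, and a diagonal
entry is a pivot that lowers the order by one. The induction ends at order one, where `f` is a
variable.

One pivot not dividing `f` lifts primality. It also lifts the bound `2` on heights: a prime over `J`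
contains `f` by Euler's formula, so it either contains both `w` and `f`, or survives inverting `w`.
When `s ≥ 3` there are two pivots `t`, `u` with `f ∉ (t, u)`. Then a prime over `J` containing both
has height at least `3`, and the others come from the smaller matrix. Since `t`, `u` is a regular
sequence modulo `f`, an integral fraction that is regular where `t` is invertible and where `u` is
invertible is regular, which gives normality without Serre's criterion.

For the upper bounds, `f` is singular where the corank is at least two, a locus cut out near a
suitable point by the three entries of a symmetric `2 × 2` Schur complement
(`IsStaircase.height_le_three`). If `s = 2`, the last row contains only two variables `t`, `u` and
crosses its column in zero, so `f ∈ (t, u)²`; this gives height at most `2` and destroys normality.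
-/

/-! ### Integrality and heights under localization -/

section CommutativeAlgebra

/-- A surjective endomorphism of a Noetherian ring is injective. -/
theorem RingHom.injective_of_surjective_of_isNoetherianRing {B : Type*} [CommRing B]
    [IsNoetherianRing B] (φ : B →+* B) (hφ : Function.Surjective φ) : Function.Injective φ := by
  have hsucc : ∀ (n : ℕ) (y : B), (φ ^ (n + 1)) y = φ ((φ ^ n) y) := by
    intro n y
    rw [pow_succ']
    rfl
  have hsurj : ∀ n : ℕ, Function.Surjective (φ ^ n) := by
    intro n
    induction n with
    | zero => exact fun y => ⟨y, rfl⟩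
    | succ n ih =>
      intro y
      obtain ⟨z, hz⟩ := hφ y
      obtain ⟨w, hw⟩ := ih z
      exact ⟨w, by rw [hsucc, hw, hz]⟩
  have hmono : Monotone fun n : ℕ => RingHom.ker (φ ^ n) := by
    refine monotone_nat_of_le_succ fun n y hy => ?_
    rw [RingHom.mem_ker] at hy ⊢
    rw [hsucc, hy, map_zero]
  obtain ⟨n, hn⟩ := monotone_stabilizes_iff_noetherian.mpr ‹IsNoetherianRing B› ⟨_, hmono⟩
  have hker : RingHom.ker (φ ^ n) = RingHom.ker (φ ^ (n + 1)) := hn (n + 1) (Nat.le_succ n)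
  rw [injective_iff_map_eq_zero]
  intro y hy
  obtain ⟨z, hz⟩ := hsurj n y
  have : z ∈ RingHom.ker (φ ^ (n + 1)) := by rw [RingHom.mem_ker, hsucc, hz, hy]
  rw [← hker, RingHom.mem_ker, hz] at this
  exact this

/-- Evaluating `p.scaleRoots b` at `a` gives `b ^ deg p * p (a / b)`. With denominators cleared,
integral closedness can be moved along ring maps without comparing fraction fields. -/
theorem isIntegrallyClosed_iff_scaleRoots {A : Type*} [CommRing A] [IsDomain A] :
    IsIntegrallyClosed A ↔ ∀ (p : Polynomial A) (a b : A), p.Monic → b ≠ 0 →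
      (p.scaleRoots b).eval a = 0 → b ∣ a := by
  rw [isIntegrallyClosed_iff (FractionRing A)]
  have hinj := IsFractionRing.injective A (FractionRing A)
  constructor
  · intro h p a b hp hb hab
    have hb' : algebraMap A (FractionRing A) b ≠ 0 := by simpa using hb
    obtain ⟨y, hy⟩ := h (x := algebraMap A _ a / algebraMap A _ b) ⟨p, hp, by
      have h1 := Polynomial.scaleRoots_eval₂_mul (p := p) (algebraMap A (FractionRing A))
        (algebraMap A _ a / algebraMap A _ b) b
      rw [mul_div_cancel₀ _ hb', Polynomial.eval₂_at_apply, hab, map_zero] at h1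
      exact (mul_eq_zero.mp h1.symm).resolve_left (pow_ne_zero _ hb')⟩
    refine ⟨y, hinj ?_⟩
    rw [map_mul, hy, mul_div_cancel₀ _ hb']
  · rintro h x ⟨p, hp, hx⟩
    obtain ⟨a, b, hb, rfl⟩ := IsFractionRing.div_surjective (A := A) x
    have h1 := Polynomial.scaleRoots_eval₂_eq_zero_of_eval₂_div_eq_zero hinj hx hb
    rw [Polynomial.eval₂_at_apply, map_eq_zero_iff _ hinj] at h1
    obtain ⟨y, rfl⟩ := h p a b hp (nonZeroDivisors.ne_zero hb) h1
    have hb' : algebraMap A (FractionRing A) b ≠ 0 := by simpa using nonZeroDivisors.ne_zero hb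
    exact ⟨y, by rw [map_mul, mul_div_cancel_left₀ _ hb']⟩

/-- An integral fraction `a / b` becomes a regular function after inverting `d`, if some injective
map to an integrally closed domain is surjective up to powers of `d`. -/
theorem exists_dvd_pow_mul_of_scaleRoots_eval_eq_zero {A A' : Type*} [CommRing A] [IsDomain A]
    [CommRing A'] [IsDomain A'] [IsIntegrallyClosed A'] (φ : A →+* A') (hφ : Function.Injective φ)
    (d : A) (hsurj : ∀ y, ∃ n z, φ z = φ d ^ n * y)
    {p : Polynomial A} {a b : A} (hp : p.Monic) (hb : b ≠ 0)
    (hab : (p.scaleRoots b).eval a = 0) : ∃ n, b ∣ d ^ n * a := by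
  have hb' : φ b ≠ 0 := by rwa [Ne, map_eq_zero_iff _ hφ]
  have h1 : ((p.map φ).scaleRoots (φ b)).eval (φ a) = 0 := by
    rw [← Polynomial.map_scaleRoots _ _ _ (by simp [hp.leadingCoeff]), Polynomial.eval_map,
      Polynomial.eval₂_at_apply, hab, map_zero]
  obtain ⟨y, hy⟩ := isIntegrallyClosed_iff_scaleRoots.mp ‹_› _ _ _ (hp.map φ) hb' h1
  obtain ⟨n, z, hz⟩ := hsurj y
  refine ⟨n, z, hφ ?_⟩
  rw [map_mul, map_mul, map_pow, hz, hy]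
  ring

/-- This is the equality `A_t ∩ A_u = A` for a regular sequence `t`, `u`, applied to the fraction `a
/ b`. -/
theorem dvd_of_dvd_pow_mul {A : Type*} [CommRing A] [IsDomain A] {t u a b : A} (ht : t ≠ 0)
    (hb : b ≠ 0) (htu : ∀ c, t ∣ u * c → t ∣ c) {n l : ℕ} (hn : b ∣ t ^ n * a)
    (hl : b ∣ u ^ l * a) : b ∣ a := by
  obtain ⟨c, hc⟩ := hn
  obtain ⟨d, hd⟩ := hl
  have hul : ∀ (l : ℕ) (c : A), t ∣ u ^ l * c → t ∣ c := by
    intro l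
    induction l with
    | zero => intro c hc; simpa using hc
    | succ l ih =>
      intro c hc
      rw [pow_succ', mul_assoc] at hc
      exact ih _ (htu _ hc)
  have hpow : ∀ (n : ℕ) (c : A), t ^ n ∣ u ^ l * c → t ^ n ∣ c := by
    intro n
    induction n with
    | zero => intro c _; simp
    | succ n ih =>
      intro c hc
      obtain ⟨c', rfl⟩ := hul l c ((dvd_pow_self t n.succ_ne_zero).trans hc)
      rw [mul_left_comm, pow_succ'] at hc
      rw [pow_succ']
      exact mul_dvd_mul_left t (ih _ ((mul_dvd_mul_iff_left ht).mp hc))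
  have hcd : u ^ l * c = t ^ n * d := by
    apply mul_left_cancel₀ hb
    rw [mul_left_comm, ← hc, mul_left_comm b, ← hd]
    ring
  obtain ⟨c', rfl⟩ := hpow n c ⟨d, hcd⟩
  refine ⟨c', mul_left_cancel₀ (pow_ne_zero n ht) ?_⟩
  rw [hc]
  ring

section SurjectiveUpToPowers

variable {R : Type*} [CommRing R] [IsNoetherianRing R] {φ : R →+* R} {d : R}

/-- An endomorphism that fixes `d` and is surjective up to powers of `d` becomes an automorphism
after inverting `d`. -/
theorem exists_localizationAway_ringEquiv (hd : φ d = d)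
    (hsurj : ∀ y, ∃ n z, φ z = d ^ n * y) :
    ∃ Φ : Localization.Away d ≃+* Localization.Away d,
      ∀ y, Φ (algebraMap R _ y) = algebraMap R _ (φ y) := by
  set B := Localization.Away d
  have hu : IsUnit (algebraMap R B d) := IsLocalization.Away.algebraMap_isUnit d
  let Φ : B →+* B := IsLocalization.Away.lift d (g := (algebraMap R B).comp φ)
    (by simpa [hd] using hu)
  have hΦ : ∀ y, Φ (algebraMap R B y) = algebraMap R B (φ y) := fun y =>
    IsLocalization.Away.lift_eq d _ y
  have hΦs : Function.Surjective Φ := by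
    intro x
    obtain ⟨l, y, hy⟩ := IsLocalization.Away.surj d x
    obtain ⟨n, z, hz⟩ := hsurj y
    obtain ⟨v, hv⟩ := hu
    have hv' : Φ (↑v⁻¹ : B) = (↑v⁻¹ : B) := by
      have h1 : Φ (↑v⁻¹ : B) * Φ v = 1 := by rw [← map_mul, Units.inv_mul, map_one]
      rw [hv, hΦ, hd, ← hv] at h1
      exact Units.eq_inv_of_mul_eq_one_right h1
    refine ⟨(↑v⁻¹ : B) ^ (n + l) * algebraMap R B z, ?_⟩
    rw [map_mul, map_pow, hv', hΦ, hz, map_mul, map_pow, ← hv, hy.symm, ← hv]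
    rw [pow_add]
    calc _ = (↑v⁻¹ * (v : B)) ^ n * (↑v⁻¹ * (v : B)) ^ l * x := by ring
      _ = x := by simp
  exact ⟨RingEquiv.ofBijective Φ ⟨Φ.injective_of_surjective_of_isNoetherianRing hΦs, hΦs⟩, hΦ⟩

theorem injective_of_surjective_up_to_powers [IsDomain R] (hd0 : d ≠ 0) (hd : φ d = d)
    (hsurj : ∀ y, ∃ n z, φ z = d ^ n * y) : Function.Injective φ := by
  obtain ⟨Φ, hΦ⟩ := exists_localizationAway_ringEquiv hd hsurj
  have hinj : Function.Injective (algebraMap R (Localization.Away d)) :=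
    IsLocalization.injective _ (powers_le_nonZeroDivisors_of_noZeroDivisors hd0)
  intro x y hxy
  apply hinj
  apply Φ.injective
  rw [hΦ, hΦ, hxy]

/-- Primes avoiding `d` correspond to primes of the localization with the same height, where `φ`
becomes an automorphism. -/
theorem exists_isPrime_height_eq_of_surjective_up_to_powers (hd : φ d = d)
    (hsurj : ∀ y, ∃ n z, φ z = d ^ n * y) (P : Ideal R) [hP : P.IsPrime] (hdP : d ∉ P) :
    ∃ Q : Ideal R, Q.IsPrime ∧ Q.height = P.height ∧ d ∉ Q ∧ ∀ y ∈ P, φ y ∈ Q := by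
  obtain ⟨Φ, hΦ⟩ := exists_localizationAway_ringEquiv hd hsurj
  set B := Localization.Away d
  have hdisj : Disjoint (Submonoid.powers d : Set R) (P : Set R) := by
    rw [Set.disjoint_left]
    rintro _ ⟨n, rfl⟩ hn
    exact hdP (hP.mem_of_pow_mem n hn)
  let PB : Ideal B := P.map (algebraMap R B)
  have hPB : PB.IsPrime := IsLocalization.isPrime_of_isPrime_disjoint (Submonoid.powers d) B P hP hdisj
  let QB : Ideal B := PB.comap Φ.symm
  have hQB : QB.IsPrime := Ideal.comap_isPrime _ _
  refine ⟨QB.under R, inferInstance, ?_, ?_, ?_⟩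
  · rw [IsLocalization.height_under (Submonoid.powers d) QB,
      ← IsLocalization.height_map_of_disjoint (S := B) (Submonoid.powers d) P hdisj]
    exact RingEquiv.height_comap Φ.symm PB
  · intro h
    exact hQB.ne_top (Ideal.eq_top_of_isUnit_mem _ h (IsLocalization.Away.algebraMap_isUnit d))
  · intro y hy
    change Φ.symm (algebraMap R B (φ y)) ∈ PB
    rw [← hΦ, RingEquiv.symm_apply_apply]
    exact Ideal.mem_map_of_mem _ hy

end SurjectiveUpToPowers

end CommutativeAlgebra

theorem le_height_iff_forall_isPrime {A : Type*} [CommRing A] {I : Ideal A} {c : ℕ∞} :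
    c ≤ I.height ↔ ∀ P : Ideal A, P.IsPrime → I ≤ P → c ≤ P.height := by
  constructor
  · exact fun h P _ hIP => h.trans (Ideal.height_mono hIP)
  · intro h
    rw [Ideal.height_eq_inf_minimalPrimes]
    exact le_iInf₂ fun P hP => h P hP.1.1 hP.1.2

/-! ### Ideals generated by variables -/

section CoordinateIdeals

open MvPolynomial

variable {σ k : Type*} [Field k]

open Classical in
/-- The retraction of a polynomial ring that sends the variables in `T` to zero. -/
noncomputable def killVars (k : Type*) [Field k] (T : Set σ) :
    MvPolynomial σ k →ₐ[k] MvPolynomial σ k :=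
  aeval fun s => if s ∈ T then 0 else X s

theorem killVars_X_of_mem {T : Set σ} {s : σ} (hs : s ∈ T) : killVars k T (X s) = 0 := by
  simp [killVars, hs]

theorem killVars_X_of_notMem {T : Set σ} {s : σ} (hs : s ∉ T) : killVars k T (X s) = X s := by
  simp [killVars, hs]

theorem sub_killVars_mem (T : Set σ) (y : MvPolynomial σ k) :
    y - killVars k T y ∈ Ideal.span (X '' T : Set (MvPolynomial σ k)) := by
  classical
  have h : (Ideal.Quotient.mkₐ k (Ideal.span (X '' T : Set (MvPolynomial σ k)))).comp
      (killVars k T) = Ideal.Quotient.mkₐ k _ := by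
    ext s
    by_cases hs : s ∈ T
    · rw [AlgHom.comp_apply, killVars_X_of_mem hs, map_zero]
      exact (Ideal.Quotient.eq_zero_iff_mem.mpr (Ideal.subset_span (Set.mem_image_of_mem X hs))).symm
    · rw [AlgHom.comp_apply, killVars_X_of_notMem hs]
  rw [← Ideal.Quotient.eq]
  exact (DFunLike.congr_fun h y).symm

theorem mem_span_X_image_iff (T : Set σ) (y : MvPolynomial σ k) :
    y ∈ Ideal.span (X '' T : Set (MvPolynomial σ k)) ↔ killVars k T y = 0 := by
  constructor
  · intro hy
    have : Ideal.span (X '' T : Set (MvPolynomial σ k)) ≤ RingHom.ker (killVars k T) := by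
      rw [Ideal.span_le]
      rintro _ ⟨s, hs, rfl⟩
      exact killVars_X_of_mem hs
    exact this hy
  · intro hy
    simpa [hy] using sub_killVars_mem T y

theorem isPrime_span_X_image (T : Set σ) :
    (Ideal.span (X '' T : Set (MvPolynomial σ k))).IsPrime := by
  have : Ideal.span (X '' T : Set (MvPolynomial σ k)) = RingHom.ker (killVars k T) := by
    ext y
    exact mem_span_X_image_iff T y
  rw [this]
  exact RingHom.ker_isPrime _

theorem X_mem_span_X_image_iff {T : Set σ} {s : σ} :
    X s ∈ Ideal.span (X '' T : Set (MvPolynomial σ k)) ↔ s ∈ T := by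
  constructor
  · intro h
    by_contra hs
    rw [mem_span_X_image_iff, killVars_X_of_notMem hs] at h
    exact X_ne_zero s h
  · exact fun h => Ideal.subset_span ⟨s, h, rfl⟩

theorem killVars_killVars (T : Set σ) (y : MvPolynomial σ k) :
    killVars k T (killVars k T y) = killVars k T y := by
  have := (mem_span_X_image_iff T _).mp (sub_killVars_mem T y)
  rw [map_sub, sub_eq_zero] at this
  exact this.symm

theorem X_dvd_iff_mem_span {s : σ} {y : MvPolynomial σ k} :
    X s ∣ y ↔ y ∈ Ideal.span (X '' {s} : Set (MvPolynomial σ k)) := by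
  rw [Set.image_singleton, Ideal.mem_span_singleton]

theorem X_not_dvd_of_notMem_span {T : Set σ} {s : σ} (hs : s ∈ T) {f : MvPolynomial σ k}
    (hf : f ∉ Ideal.span (X '' T : Set (MvPolynomial σ k))) : ¬ X s ∣ f := fun h =>
  hf (Ideal.mem_of_dvd _ h (X_mem_span_X_image_iff.mpr hs))

/-- A prime ideal containing a variable and a polynomial not divisible by it has height at
least two. -/
theorem two_le_height_of_X_mem {t : σ} {f : MvPolynomial σ k} (hf : ¬ X t ∣ f)
    (P : Ideal (MvPolynomial σ k)) [P.IsPrime] (hfP : f ∈ P) (htP : X t ∈ P) : 2 ≤ P.height := by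
  have h1 := isPrime_span_X_image (k := k) {t}
  have hlt : (⊥ : Ideal (MvPolynomial σ k)) < Ideal.span (X '' {t}) :=
    bot_lt_iff_ne_bot.mpr fun h => X_ne_zero (R := k) t
      (by rw [← Ideal.mem_bot, ← h]; exact X_mem_span_X_image_iff.mpr rfl)
  have hlt' : Ideal.span (X '' {t}) < P := by
    refine lt_of_le_of_ne ?_ fun h => hf (X_dvd_iff_mem_span.mpr (h ▸ hfP))
    rw [Ideal.span_le]
    rintro _ ⟨s, rfl, rfl⟩
    exact htP
  have e1 := Ideal.height_add_one_le_of_lt_of_isPrime hlt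
  have e2 := Ideal.height_add_one_le_of_lt_of_isPrime hlt'
  rw [Ideal.height_bot, zero_add] at e1
  calc (2 : ℕ∞) = 1 + 1 := by norm_num
    _ ≤ _ := by gcongr
    _ ≤ _ := e2

/-- A prime ideal containing two variables and a polynomial outside the ideal of these variables
has height at least three. -/
theorem three_le_height_of_X_mem {t u : σ} (htu : t ≠ u) {f : MvPolynomial σ k}
    (hf : f ∉ Ideal.span (X '' {t, u} : Set (MvPolynomial σ k)))
    (P : Ideal (MvPolynomial σ k)) [P.IsPrime] (hfP : f ∈ P) (htP : X t ∈ P) (huP : X u ∈ P) :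
    3 ≤ P.height := by
  have h1 := isPrime_span_X_image (k := k) {t, u}
  have e1 : 2 ≤ (Ideal.span (X '' {t, u} : Set (MvPolynomial σ k))).height :=
    two_le_height_of_X_mem (t := t) (f := X u)
      (by rw [X_dvd_iff_mem_span, X_mem_span_X_image_iff]; exact fun h => htu h.symm) _
      (X_mem_span_X_image_iff.mpr (by simp)) (X_mem_span_X_image_iff.mpr (by simp))
  have hlt : Ideal.span (X '' {t, u}) < P := by
    refine lt_of_le_of_ne ?_ fun h => hf (h ▸ hfP)
    rw [Ideal.span_le]
    rintro _ ⟨s, rfl | rfl, rfl⟩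
    exacts [htP, huP]
  have e2 := Ideal.height_add_one_le_of_lt_of_isPrime hlt
  calc (3 : ℕ∞) = 2 + 1 := by norm_num
    _ ≤ _ := by gcongr
    _ ≤ _ := e2

theorem dvd_of_dvd_X_pow_mul {t : σ} {f a : MvPolynomial σ k} (hf : ¬ X t ∣ f) {n : ℕ}
    (h : f ∣ X t ^ n * a) : f ∣ a := by
  obtain ⟨c, hc⟩ := h
  obtain ⟨c', rfl⟩ := (X_prime (R := k) (i := t)).pow_dvd_of_dvd_mul_left n hf ⟨a, hc.symm⟩
  refine ⟨c', mul_left_cancel₀ (pow_ne_zero n (X_ne_zero t)) ?_⟩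
  rw [hc]
  ring

theorem isDomain_quotient_span_singleton {A : Type*} [CommRing A] {f : A} (hf : Prime f) :
    IsDomain (A ⧸ Ideal.span {f}) :=
  (Ideal.Quotient.isDomain_iff_prime _).mpr ((Ideal.span_singleton_prime hf.ne_zero).mpr hf)

/-- The quotient embeds in the polynomial ring with the quotient map as a retraction, so
divisibility found upstairs descends. -/
theorem isIntegrallyClosed_quotient_X (s : σ) :
    IsIntegrallyClosed (MvPolynomial σ k ⧸ Ideal.span {(X s : MvPolynomial σ k)}) := by
  have := isDomain_quotient_span_singleton (X_prime (R := k) (i := s))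
  set π := killVars k ({s} : Set σ)
  let π' : (MvPolynomial σ k ⧸ Ideal.span {(X s : MvPolynomial σ k)}) →+* MvPolynomial σ k :=
    Ideal.Quotient.lift _ π.toRingHom fun y hy => by
      rwa [← Set.image_singleton, mem_span_X_image_iff] at hy
  have hπ' : ∀ y, π' (Ideal.Quotient.mk _ y) = π y := fun y => rfl
  have hmk : ∀ y, Ideal.Quotient.mk (Ideal.span {(X s : MvPolynomial σ k)}) (π' y) = y := by
    intro y
    obtain ⟨y, rfl⟩ := Ideal.Quotient.mk_surjective y
    rw [hπ', eq_comm, Ideal.Quotient.eq, ← Set.image_singleton]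
    exact sub_killVars_mem _ y
  have hinj : Function.Injective π' := Function.LeftInverse.injective hmk
  rw [isIntegrallyClosed_iff_scaleRoots]
  intro p a b hp hb hab
  obtain ⟨y, hy⟩ := isIntegrallyClosed_iff_scaleRoots.mp
    (inferInstance : IsIntegrallyClosed (MvPolynomial σ k)) (p.map π') (π' a) (π' b) (hp.map π')
    (by rwa [Ne, map_eq_zero_iff _ hinj])
    (by rw [← Polynomial.map_scaleRoots _ _ _ (by simp [hp.leadingCoeff]), Polynomial.eval_map,
      Polynomial.eval₂_at_apply, hab, map_zero])
  exact ⟨Ideal.Quotient.mk _ y, by rw [← hmk a, hy, map_mul, hmk]⟩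

end CoordinateIdeals

/-! ### Transfer of primality, heights and normality along a pivot -/

section PivotReduction

open MvPolynomial

variable {σ k : Type*} [Field k]

/-- `f` becomes `f'` times a unit after inverting the variable `w` and changing coordinates. The
coordinate change is given by an endomorphism of the polynomial ring that is bijective after
inverting a divisor `d` of a power of `w`. -/
def PivotReduction (w : σ) (f f' : MvPolynomial σ k) : Prop :=
  ∃ (φ : MvPolynomial σ k →ₐ[k] MvPolynomial σ k) (d : MvPolynomial σ k),
    (∃ n, d ∣ X w ^ n) ∧ φ d = d ∧ (∀ y, ∃ n z, φ z = d ^ n * y) ∧ φ f = d * f' ∧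
      ∀ s, pderiv s f' = 0 ∨ d * pderiv s f' = φ (pderiv s f)

variable [Finite σ] {w : σ} {f f' : MvPolynomial σ k}

/-- A cofactor of `f'` lifts through `φ` up to a power of `d`, and injectivity of `φ` then gives `f
∣ d ^ (n + 1) * a`. The power of `d` cancels because it divides a power of the prime `X w`, which
does not divide `f`. -/
theorem dvd_of_dvd_map {φ : MvPolynomial σ k →ₐ[k] MvPolynomial σ k} {d : MvPolynomial σ k}
    (hdw : ∃ n, d ∣ X w ^ n) (hd : φ d = d) (hsurj : ∀ y, ∃ n z, φ z = d ^ n * y)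
    (hff' : φ f = d * f') (hw : ¬ X w ∣ f) {a : MvPolynomial σ k} (ha : f' ∣ φ a) : f ∣ a := by
  obtain ⟨N, hN⟩ := hdw
  have hd0 : d ≠ 0 := fun h => pow_ne_zero N (X_ne_zero w) (zero_dvd_iff.mp (h ▸ hN))
  have hinj := injective_of_surjective_up_to_powers (φ := φ.toRingHom) hd0 hd hsurj
  obtain ⟨c, hc⟩ := ha
  obtain ⟨n, z, hz⟩ := hsurj c
  have h : f * z = d ^ (n + 1) * a := by
    apply hinj
    change φ (f * z) = φ (d ^ (n + 1) * a)
    rw [map_mul, map_mul, map_pow, hd, hff', hz, hc]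
    ring
  have h2 : f ∣ d ^ (n + 1) * a := ⟨z, h.symm⟩
  apply dvd_of_dvd_X_pow_mul hw (n := N * (n + 1))
  rw [pow_mul]
  exact h2.trans (mul_dvd_mul_right (pow_dvd_pow_of_dvd hN _) a)

theorem PivotReduction.prime (h : PivotReduction w f f') (hf' : Prime f') (hw : ¬ X w ∣ f) :
    Prime f := by
  obtain ⟨φ, d, hdw, hd, hsurj, hff', -⟩ := h
  refine ⟨fun h0 => hw (h0 ▸ dvd_zero _), fun hu => hf'.not_isUnit
    (isUnit_of_dvd_unit ⟨d, by rw [hff', mul_comm]⟩ (hu.map φ)), fun a b ⟨c, hc⟩ => ?_⟩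
  have : f' ∣ φ a * φ b := by
    rw [← map_mul, hc, map_mul, hff']
    exact ⟨d * φ c, by ring⟩
  exact (hf'.dvd_or_dvd this).imp (dvd_of_dvd_map hdw hd hsurj hff' hw)
    (dvd_of_dvd_map hdw hd hsurj hff' hw)

theorem PivotReduction.exists_isPrime (h : PivotReduction w f f')
    (P : Ideal (MvPolynomial σ k)) [P.IsPrime] (hP : gradientIdeal f ≤ P) (hw : X w ∉ P) :
    ∃ Q : Ideal (MvPolynomial σ k), Q.IsPrime ∧ Q.height = P.height ∧ gradientIdeal f' ≤ Q := by
  obtain ⟨φ, d, ⟨N, hN⟩, hd, hsurj, hff', hder⟩ := h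
  have hdP : d ∉ P := fun h => hw (Ideal.IsPrime.mem_of_pow_mem ‹_› N (Ideal.mem_of_dvd _ hN h))
  obtain ⟨Q, hQ, hQh, hdQ, hQP⟩ :=
    exists_isPrime_height_eq_of_surjective_up_to_powers (φ := φ.toRingHom) hd hsurj P hdP
  refine ⟨Q, hQ, hQh, ?_⟩
  rw [gradientIdeal, Ideal.span_le]
  rintro _ ⟨s, rfl⟩
  rcases hder s with h0 | h0
  · change pderiv s f' ∈ Q
    rw [h0]
    exact Q.zero_mem
  · have h1 : d * pderiv s f' ∈ Q := by
      rw [h0]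
      exact hQP _ (hP (Ideal.subset_span ⟨s, rfl⟩))
    exact (hQ.mem_or_mem h1).resolve_left hdQ

theorem PivotReduction.two_le_height (h : PivotReduction w f f')
    (hf' : 2 ≤ (gradientIdeal f').height) (hw : ¬ X w ∣ f) (hf : f ∈ gradientIdeal f) :
    2 ≤ (gradientIdeal f).height := by
  rw [le_height_iff_forall_isPrime]
  intro P hP hfP
  by_cases hwP : X w ∈ P
  · exact two_le_height_of_X_mem hw P (hfP hf) hwP
  · obtain ⟨Q, hQ, hQh, hQf⟩ := h.exists_isPrime P hfP hwP
    rw [← hQh]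
    exact hf'.trans (Ideal.height_mono hQf)

/-- Two pivots are needed because a prime containing only one of them is guaranteed no more than
height two directly; it is treated by inverting the other. -/
theorem three_le_height_gradientIdeal {t u : σ} (htu : t ≠ u) {g₁ g₂ : MvPolynomial σ k}
    (h₁ : PivotReduction t f g₁) (h₂ : PivotReduction u f g₂)
    (hg₁ : 3 ≤ (gradientIdeal g₁).height) (hg₂ : 3 ≤ (gradientIdeal g₂).height)
    (hftu : f ∉ Ideal.span (X '' {t, u} : Set (MvPolynomial σ k))) (hf : f ∈ gradientIdeal f) :
    3 ≤ (gradientIdeal f).height := by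
  rw [le_height_iff_forall_isPrime]
  intro P hP hfP
  by_cases htP : X t ∈ P
  · by_cases huP : X u ∈ P
    · exact three_le_height_of_X_mem htu hftu P (hfP hf) htP huP
    · obtain ⟨Q, hQ, hQh, hQf⟩ := h₂.exists_isPrime P hfP huP
      rw [← hQh]
      exact hg₂.trans (Ideal.height_mono hQf)
  · obtain ⟨Q, hQ, hQh, hQf⟩ := h₁.exists_isPrime P hfP htP
    rw [← hQh]
    exact hg₁.trans (Ideal.height_mono hQf)

theorem PivotReduction.exists_dvd_pow_mul (h : PivotReduction w f f') (hfp : Prime f)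
    (hf' : Prime f') [IsIntegrallyClosed (MvPolynomial σ k ⧸ Ideal.span {f'})] (hw : ¬ X w ∣ f)
    {p : Polynomial (MvPolynomial σ k ⧸ Ideal.span {f})}
    {a b : MvPolynomial σ k ⧸ Ideal.span {f}} (hp : p.Monic) (hb : b ≠ 0)
    (hab : (p.scaleRoots b).eval a = 0) :
    ∃ n, b ∣ (Ideal.Quotient.mk (Ideal.span {f}) (X w)) ^ n * a := by
  have := isDomain_quotient_span_singleton hfp
  have := isDomain_quotient_span_singleton hf'
  obtain ⟨φ, d, ⟨N, hN⟩, hd, hsurj, hff', -⟩ := h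
  let φ' : (MvPolynomial σ k ⧸ Ideal.span {f}) →+* (MvPolynomial σ k ⧸ Ideal.span {f'}) :=
    Ideal.quotientMap _ φ.toRingHom (by
      rw [Ideal.span_singleton_le_iff_mem, Ideal.mem_comap, Ideal.mem_span_singleton]
      exact ⟨d, by rw [mul_comm]; exact hff'⟩)
  have hφ' : ∀ y, φ' (Ideal.Quotient.mk _ y) = Ideal.Quotient.mk _ (φ y) := fun y =>
    Ideal.quotientMap_mk
  have hinj : Function.Injective φ' := by
    rw [injective_iff_map_eq_zero]
    intro y hy
    obtain ⟨y, rfl⟩ := Ideal.Quotient.mk_surjective y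
    rw [hφ', Ideal.Quotient.eq_zero_iff_dvd] at hy
    rw [Ideal.Quotient.eq_zero_iff_dvd]
    exact dvd_of_dvd_map ⟨N, hN⟩ hd hsurj hff' hw hy
  obtain ⟨n, hn⟩ := exists_dvd_pow_mul_of_scaleRoots_eval_eq_zero φ' hinj
    (Ideal.Quotient.mk _ d) (by
      intro y
      obtain ⟨y, rfl⟩ := Ideal.Quotient.mk_surjective y
      obtain ⟨n, z, hz⟩ := hsurj y
      exact ⟨n, Ideal.Quotient.mk _ z, by rw [hφ', hφ', hd, hz, map_mul, map_pow]⟩) hp hb hab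
  refine ⟨N * n, hn.trans (mul_dvd_mul_right ?_ a)⟩
  have h1 := pow_dvd_pow_of_dvd (map_dvd (Ideal.Quotient.mk (Ideal.span {f})) hN) n
  rwa [map_pow, ← pow_mul] at h1

theorem isIntegrallyClosed_quotient_of_pivotReduction {t u : σ} (htu : t ≠ u)
    {g₁ g₂ : MvPolynomial σ k} (h₁ : PivotReduction t f g₁) (h₂ : PivotReduction u f g₂)
    (hf : Prime f) (hg₁ : Prime g₁) (hg₂ : Prime g₂)
    [IsIntegrallyClosed (MvPolynomial σ k ⧸ Ideal.span {g₁})]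
    [IsIntegrallyClosed (MvPolynomial σ k ⧸ Ideal.span {g₂})]
    (hftu : f ∉ Ideal.span (X '' {t, u} : Set (MvPolynomial σ k))) :
    IsIntegrallyClosed (MvPolynomial σ k ⧸ Ideal.span {f}) := by
  have := isDomain_quotient_span_singleton hf
  have ht : ¬ X t ∣ f := X_not_dvd_of_notMem_span (by simp) hftu
  have hu : ¬ X u ∣ f := X_not_dvd_of_notMem_span (by simp) hftu
  rw [isIntegrallyClosed_iff_scaleRoots]
  intro p a b hp hb hab
  obtain ⟨n, hn⟩ := h₁.exists_dvd_pow_mul hf hg₁ ht hp hb hab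
  obtain ⟨l, hl⟩ := h₂.exists_dvd_pow_mul hf hg₂ hu hp hb hab
  refine dvd_of_dvd_pow_mul ?_ hb ?_ hn hl
  · rw [Ne, Ideal.Quotient.eq_zero_iff_dvd]
    intro h
    exact ht (hf.irreducible.dvd_symm X_prime.irreducible h)
  -- Regularity of `u` modulo `(f, t)`: setting `t = 0` leaves a polynomial `π f` not divisible by
  -- the prime `X u`, as `f ∉ (t, u)`.
  · intro c hc
    obtain ⟨c, rfl⟩ := Ideal.Quotient.mk_surjective c
    obtain ⟨b', hb'⟩ := hc
    obtain ⟨b', rfl⟩ := Ideal.Quotient.mk_surjective b'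
    rw [← map_mul, ← map_mul, Ideal.Quotient.eq, Ideal.mem_span_singleton] at hb'
    obtain ⟨e, he⟩ := hb'
    set π := killVars k ({t} : Set σ)
    have hπt : π (X t) = 0 := killVars_X_of_mem rfl
    have hπu : π (X u) = X u := killVars_X_of_notMem fun h => htu h.symm
    have h1 : X u * π c = π f * π e := by
      have := congrArg π he
      rwa [map_sub, map_mul, map_mul, map_mul, hπt, hπu, zero_mul, sub_zero] at this
    have h2 : ¬ X u ∣ π f := by
      intro h
      apply hftu
      have h3 := sub_killVars_mem ({t} : Set σ) f
      have h4 : π f ∈ Ideal.span (X '' {t, u} : Set (MvPolynomial σ k)) :=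
        Ideal.mem_of_dvd _ h (X_mem_span_X_image_iff.mpr (by simp))
      have h5 := Ideal.add_mem _ (Ideal.span_mono (Set.image_mono (by simp)) h3) h4
      simpa [π] using h5
    obtain ⟨e', he'⟩ := ((X_prime (R := k) (i := u)).dvd_or_dvd ⟨_, h1.symm⟩).resolve_left h2
    have h6 : π c = π f * e' := by
      apply mul_left_cancel₀ (X_ne_zero (R := k) u)
      rw [h1, he']
      ring
    have h7 : X t ∣ c - f * e' := by
      rw [X_dvd_iff_mem_span, mem_span_X_image_iff]
      change π (c - f * e') = 0
      rw [map_sub, map_mul]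
      have : π (π c) = π c := killVars_killVars _ c
      rw [← this, h6, map_mul, killVars_killVars, sub_self]
    obtain ⟨v, hv⟩ := h7
    refine ⟨Ideal.Quotient.mk _ v, ?_⟩
    rw [← map_mul, ← hv, Ideal.Quotient.eq, Ideal.mem_span_singleton]
    exact ⟨e', by ring⟩

end PivotReduction

/-! ### Symmetric matrices of variables and Schur complements -/

section Labelings

open MvPolynomial

variable {σ k ι κ μ : Type*} [Field k]

/-- A partial labeling of the entries of a square matrix by variables, such that two entries have
the same label only if they agree up to transposition. -/
structure IsSymmLabeling (e : ι → ι → Option σ) : Prop where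
  symm : ∀ i j, e i j = e j i
  inj : ∀ {i j i' j' s}, e i j = some s → e i' j' = some s → (i = i' ∧ j = j') ∨ (i = j' ∧ j = i')

/-- The matrix of variables given by a partial labeling; entries without label are zero. -/
noncomputable def labelMatrix (k : Type*) [Field k] (e : ι → ι → Option σ) :
    Matrix ι ι (MvPolynomial σ k) :=
  Matrix.of fun i j => (e i j).elim 0 X

theorem labelMatrix_apply (e : ι → ι → Option σ) (i j : ι) :
    labelMatrix k e i j = (e i j).elim 0 X := rfl

theorem labelMatrix_of_none {e : ι → ι → Option σ} {i j : ι} (h : e i j = none) :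
    labelMatrix k e i j = 0 := by
  rw [labelMatrix_apply, h]
  rfl

theorem labelMatrix_of_some {e : ι → ι → Option σ} {i j : ι} {s : σ} (h : e i j = some s) :
    labelMatrix k e i j = X s := by
  rw [labelMatrix_apply, h]
  rfl

theorem IsSymmLabeling.transpose_labelMatrix {e : ι → ι → Option σ} (he : IsSymmLabeling e) :
    (labelMatrix k e).transpose = labelMatrix k e := by
  ext1 i j
  rw [Matrix.transpose_apply, labelMatrix_apply, labelMatrix_apply, he.symm]

theorem IsSymmLabeling.comp {e : ι → ι → Option σ} (he : IsSymmLabeling e) {θ : κ → ι}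
    (hθ : Function.Injective θ) : IsSymmLabeling fun i j => e (θ i) (θ j) where
  symm i j := he.symm _ _
  inj h h' := by simpa only [hθ.eq_iff] using he.inj h h'

theorem det_labelMatrix_comp_equiv [Fintype ι] [DecidableEq ι] [Fintype κ] [DecidableEq κ]
    (e : ι → ι → Option σ) (θ : κ ≃ ι) :
    (labelMatrix k fun i j => e (θ i) (θ j)).det = (labelMatrix k e).det :=
  Matrix.det_submatrix_equiv_self θ (labelMatrix k e)

theorem Subalgebra.det_mem {A : Type*} [CommRing A] [Algebra k A] [Fintype κ] [DecidableEq κ]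
    (T : Subalgebra k A) {M : Matrix κ κ A} (hM : ∀ i j, M i j ∈ T) : M.det ∈ T := by
  rw [Matrix.det_apply]
  exact T.sum_mem fun τ _ => T.toSubring.toAddSubgroup.zsmul_mem
    (T.prod_mem fun i _ => hM _ _) _

theorem Subalgebra.adjugate_mem {A : Type*} [CommRing A] [Algebra k A] [Fintype κ]
    [DecidableEq κ] (T : Subalgebra k A) {M : Matrix κ κ A} (hM : ∀ i j, M i j ∈ T) (i j : κ) :
    M.adjugate i j ∈ T := by
  rw [Matrix.adjugate_apply]
  refine T.det_mem fun a b => ?_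
  rw [Matrix.updateRow_apply, Pi.single_apply]
  split_ifs
  exacts [T.one_mem, T.zero_mem, hM a b]

/-- Column elimination would use `P⁻¹`; scaling the off-diagonal blocks by `P.det` replaces it by
the adjugate, so the identity holds over any commutative ring. -/
theorem det_fromBlocks_add_adjugate {A : Type*} [CommRing A] [Fintype κ] [DecidableEq κ]
    [Fintype μ] [DecidableEq μ] (P : Matrix κ κ A) (B : Matrix κ μ A) (C : Matrix μ κ A)
    (D : Matrix μ μ A) :
    (Matrix.fromBlocks P (P.det • B) (P.det • C) (D + P.det • (C * P.adjugate * B))).det =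
      P.det * D.det := by
  have h : Matrix.fromBlocks P (P.det • B) (P.det • C) (D + P.det • (C * P.adjugate * B)) *
      Matrix.fromBlocks 1 (-(P.adjugate * B)) 0 1 = Matrix.fromBlocks P 0 (P.det • C) D := by
    rw [Matrix.fromBlocks_multiply]
    congr 1
    · simp
    · rw [Matrix.mul_neg, ← Matrix.mul_assoc, Matrix.mul_adjugate, Matrix.smul_mul, Matrix.one_mul,
        Matrix.mul_one, neg_add_cancel]
    · simp
    · rw [Matrix.mul_neg, Matrix.smul_mul, ← Matrix.mul_assoc, Matrix.mul_one]
      abel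
  have h' := congrArg Matrix.det h
  rwa [Matrix.det_mul, Matrix.det_fromBlocks_zero₂₁, Matrix.det_one, Matrix.det_one, mul_one,
    mul_one, Matrix.det_fromBlocks_zero₁₂] at h'

theorem pderiv_eq_zero_of_mem_supported {L : Set σ} {y : MvPolynomial σ k}
    (hy : y ∈ supported k L) {s : σ} (hs : s ∉ L) : pderiv s y = 0 := by
  apply pderiv_eq_zero_of_notMem_vars
  exact fun h => hs (mem_supported.mp hy h)

theorem pderiv_map_of_pderiv_map_X {φ : MvPolynomial σ k →ₐ[k] MvPolynomial σ k} {s : σ}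
    (h : ∀ r, pderiv s (φ (X r)) = φ (pderiv s (X r))) (y : MvPolynomial σ k) :
    pderiv s (φ y) = φ (pderiv s y) := by
  induction y using MvPolynomial.induction_on with
  | C a =>
    rw [← MvPolynomial.algebraMap_eq, φ.commutes, MvPolynomial.algebraMap_eq, pderiv_C, map_zero]
  | add p q hp hq => simp only [map_add, hp, hq]
  | mul_X p r hp =>
    rw [map_mul, Derivation.leibniz, Derivation.leibniz, h, hp, map_add, smul_eq_mul, smul_eq_mul,
      smul_eq_mul, smul_eq_mul, map_mul, map_mul]

variable [Fintype κ] [DecidableEq κ] [Fintype μ] [DecidableEq μ]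

/-- Splitting off a block whose determinant divides a power of a variable. -/
theorem pivotReduction_of_labeling {e : κ ⊕ μ → κ ⊕ μ → Option σ} (he : IsSymmLabeling e) {w : σ}
    (hw : ∃ n, (labelMatrix k e).toBlocks₁₁.det ∣ X w ^ n)
    (hZ : ∀ i j, e (.inr i) (.inr j) = none → ((labelMatrix k e).toBlocks₂₁ *
      (labelMatrix k e).toBlocks₁₁.adjugate * (labelMatrix k e).toBlocks₁₂) i j = 0) :
    PivotReduction w (labelMatrix k e).det
      (labelMatrix k fun i j : μ => e (.inr i) (.inr j)).det := by
  classical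
  set M := labelMatrix k e
  set A := M.toBlocks₁₁
  set B := M.toBlocks₁₂
  set C := M.toBlocks₂₁
  set D := labelMatrix k fun i j : μ => e (.inr i) (.inr j)
  set S := C * A.adjugate * B with hS
  have hMblocks : M = Matrix.fromBlocks A B C D := (Matrix.fromBlocks_toBlocks M).symm
  have hMt : M.transpose = M := he.transpose_labelMatrix
  have hAt : A.transpose = A := by
    ext1 i j
    exact congrFun (congrFun hMt (.inl i)) (.inl j)
  have hBt : B.transpose = C := by
    ext1 i j
    exact congrFun (congrFun hMt (.inr i)) (.inl j)
  have hCt : C.transpose = B := by rw [← hBt, Matrix.transpose_transpose]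
  have hSt : ∀ i j, S i j = S j i := by
    have : S.transpose = S := by
      rw [hS, Matrix.transpose_mul, Matrix.transpose_mul, Matrix.adjugate_transpose, hAt, hBt, hCt,
        Matrix.mul_assoc]
    exact fun i j => congrFun (congrFun this j) i
  let L : Set σ := {s | ∃ p : μ × μ, e (.inr p.1) (.inr p.2) = some s}
  let N : Set σ := {s | ∃ p : κ × μ, e (.inl p.1) (.inr p.2) = some s}
  -- The coordinate change scales the off-diagonal blocks by `A.det` and shifts the block `D` by the
  -- Schur correction. A label in `L` determines its position only up to transposition, so the
  -- choice is harmless because `S` is symmetric. The hypothesis `hZ` ensures that the zeros of `D`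
  -- need no shift.
  let g : σ → MvPolynomial σ k := fun s =>
    if h : s ∈ L then X s + A.det * S h.choose.1 h.choose.2
    else if s ∈ N then A.det * X s else X s
  let φ : MvPolynomial σ k →ₐ[k] MvPolynomial σ k := aeval g
  have hφX : ∀ s, φ (X s) = g s := fun s => aeval_X g s
  have hAL : ∀ i j, A i j ∈ supported k Lᶜ := by
    intro i j
    change (e (.inl i) (.inl j)).elim 0 X ∈ _
    cases h : e (.inl i) (.inl j) with
    | none => exact Subalgebra.zero_mem _
    | some s =>
      refine (X_mem_supported (R := k)).mpr ?_
      rintro ⟨p, hp⟩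
      have := he.inj h hp
      simp at this
  have hBN : ∀ {i : κ} {j : μ} {s}, e (.inl i) (.inr j) = some s → s ∉ L := by
    rintro i j s h ⟨p, hp⟩
    have := he.inj h hp
    simp at this
  have hBL : ∀ i j, B i j ∈ supported k Lᶜ := by
    intro i j
    change (e (.inl i) (.inr j)).elim 0 X ∈ _
    cases h : e (.inl i) (.inr j) with
    | none => exact Subalgebra.zero_mem _
    | some s => exact (X_mem_supported (R := k)).mpr (hBN h)
  have hCL : ∀ i j, C i j ∈ supported k Lᶜ := by
    intro i j
    rw [← hBt]
    exact hBL j i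
  have hdL : A.det ∈ supported k Lᶜ := Subalgebra.det_mem _ hAL
  have hSL : ∀ i j, S i j ∈ supported k Lᶜ := by
    intro i j
    rw [hS, Matrix.mul_apply]
    refine Subalgebra.sum_mem _ fun b _ => Subalgebra.mul_mem _ ?_ (hBL b j)
    rw [Matrix.mul_apply]
    exact Subalgebra.sum_mem _ fun a _ =>
      Subalgebra.mul_mem _ (hCL i a) (Subalgebra.adjugate_mem _ hAL a b)
  have hgL : ∀ s ∈ L, g s - X s ∈ supported k Lᶜ := by
    intro s hs
    simp only [g, dif_pos hs, add_sub_cancel_left]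
    exact Subalgebra.mul_mem _ hdL (hSL _ _)
  have hφA : ∀ i j, φ (A i j) = A i j := by
    intro i j
    change φ ((e (.inl i) (.inl j)).elim 0 X) = (e (.inl i) (.inl j)).elim 0 X
    cases h : e (.inl i) (.inl j) with
    | none => exact map_zero φ
    | some s =>
      have h1 : s ∉ L := by
        rintro ⟨p, hp⟩
        have := he.inj h hp
        simp at this
      have h2 : s ∉ N := by
        rintro ⟨p, hp⟩
        have := he.inj h hp
        simp at this
      change φ (X s) = X s
      rw [hφX]
      simp only [g, dif_neg h1, if_neg h2]
  have hφB : ∀ i j, φ (B i j) = A.det * B i j := by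
    intro i j
    change φ ((e (.inl i) (.inr j)).elim 0 X) = A.det * (e (.inl i) (.inr j)).elim 0 X
    cases h : e (.inl i) (.inr j) with
    | none =>
      change φ 0 = A.det * 0
      rw [map_zero, mul_zero]
    | some s =>
      have h1 : s ∉ L := hBN h
      have h2 : s ∈ N := ⟨(i, j), h⟩
      change φ (X s) = A.det * X s
      rw [hφX]
      simp only [g, dif_neg h1, if_pos h2]
  have hφD : ∀ i j, φ (D i j) = D i j + A.det * S i j := by
    intro i j
    change φ ((e (.inr i) (.inr j)).elim 0 X) = (e (.inr i) (.inr j)).elim 0 X + _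
    cases h : e (.inr i) (.inr j) with
    | none =>
      change φ 0 = 0 + A.det * S i j
      rw [map_zero, hZ i j h, mul_zero, add_zero]
    | some s =>
      have h1 : s ∈ L := ⟨(i, j), h⟩
      have h2 := h1.choose_spec
      change φ (X s) = X s + A.det * S i j
      rw [hφX]
      simp only [g, dif_pos h1]
      rcases he.inj h h2 with ⟨h3, h4⟩ | ⟨h3, h4⟩
      · rw [← Sum.inr_injective h3, ← Sum.inr_injective h4]
      · rw [← Sum.inr_injective h3, ← Sum.inr_injective h4, hSt]
  have hφd : φ A.det = A.det := by
    rw [AlgHom.map_det]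
    congr 1
    ext1 i j
    exact hφA i j
  have hφf : φ M.det = A.det * D.det := by
    rw [AlgHom.map_det, ← det_fromBlocks_add_adjugate A B C D]
    congr 1
    rw [hMblocks]
    ext1 i j
    rcases i with i | i <;> rcases j with j | j
    · exact hφA i j
    · exact hφB i j
    · change φ (C i j) = A.det * C i j
      rw [← hBt]
      exact hφB j i
    · exact hφD i j
  -- The elements reached by `φ` up to powers of `A.det` form a subalgebra, so surjectivity need
  -- only be checked on variables.
  let T : Subalgebra k (MvPolynomial σ k) :=
    { carrier := {y | ∃ n z, φ z = A.det ^ n * y}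
      mul_mem' := by
        rintro y y' ⟨n, z, hz⟩ ⟨n', z', hz'⟩
        exact ⟨n + n', z * z', by rw [map_mul, hz, hz']; ring⟩
      add_mem' := by
        rintro y y' ⟨n, z, hz⟩ ⟨n', z', hz'⟩
        refine ⟨n + n', A.det ^ n' * z + A.det ^ n * z', ?_⟩
        rw [map_add, map_mul, map_mul, map_pow, map_pow, hφd, hz, hz']
        ring
      algebraMap_mem' := fun a => ⟨0, algebraMap _ _ a, by rw [φ.commutes, pow_zero, one_mul]⟩ }
  have hXT : ∀ s ∉ L, X s ∈ T := by
    intro s hs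
    by_cases h : s ∈ N
    · refine ⟨1, X s, ?_⟩
      rw [hφX]
      simp only [g, dif_neg hs, if_pos h, pow_one]
    · refine ⟨0, X s, ?_⟩
      rw [hφX]
      simp only [g, dif_neg hs, if_neg h, pow_zero, one_mul]
  have hsT : supported k Lᶜ ≤ T := by
    rw [supported, Algebra.adjoin_le_iff]
    rintro _ ⟨s, hs, rfl⟩
    exact hXT s hs
  have hT : T = ⊤ := by
    rw [eq_top_iff, ← adjoin_range_X, Algebra.adjoin_le_iff]
    rintro _ ⟨s, rfl⟩
    by_cases hs : s ∈ L
    · have h1 : φ (X s) ∈ T := ⟨0, X s, by rw [pow_zero, one_mul]⟩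
      have h2 := T.sub_mem h1 (hsT (hgL s hs))
      rwa [hφX, sub_sub_cancel] at h2
    · exact hXT s hs
  refine ⟨φ, A.det, hw, hφd, fun y => ?_, hφf, fun s => ?_⟩
  · have : y ∈ T := hT ▸ Algebra.mem_top
    exact this
  -- For `s ∈ L`, the map `φ` changes variables of `L` only by terms free of `L` and sends the other
  -- variables to polynomials free of `L`, so it commutes with `pderiv s`. For `s ∉ L`, the smaller
  -- determinant does not involve `X s`.
  · by_cases hs : s ∈ L
    · right
      rw [← pderiv_map_of_pderiv_map_X, hφf, Derivation.leibniz,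
        pderiv_eq_zero_of_mem_supported hdL (fun h => h hs), smul_zero, add_zero, smul_eq_mul]
      intro r
      rw [hφX, pderiv_X, Pi.single_apply]
      by_cases hr : r ∈ L
      · have h1 := pderiv_eq_zero_of_mem_supported (hgL r hr) (s := s) (fun h => h hs)
        rw [map_sub, sub_eq_zero] at h1
        rw [h1, pderiv_X, Pi.single_apply]
        split_ifs <;> simp
      · have hrs : r ≠ s := fun h => hr (h ▸ hs)
        have h1 : g r ∈ supported k Lᶜ := by
          simp only [g, dif_neg hr]
          split_ifs
          · exact Subalgebra.mul_mem _ hdL ((X_mem_supported (R := k)).mpr hr)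
          · exact (X_mem_supported (R := k)).mpr hr
        rw [pderiv_eq_zero_of_mem_supported h1 (fun h => h hs), if_neg hrs, map_zero]
    · left
      refine pderiv_eq_zero_of_mem_supported (L := L) (Subalgebra.det_mem _ fun i j => ?_) hs
      change (e (.inr i) (.inr j)).elim 0 X ∈ _
      cases h : e (.inr i) (.inr j) with
      | none => exact Subalgebra.zero_mem _
      | some s => exact (X_mem_supported (R := k)).mpr ⟨(i, j), h⟩

end Labelings

/-! ### Staircase matrices and their pivots -/

section Staircase

open MvPolynomial

variable {σ k ι : Type*} [Field k]

theorem isHomogeneous_det_labelMatrix [Fintype ι] [DecidableEq ι] (e : ι → ι → Option σ) :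
    (labelMatrix k e).det.IsHomogeneous (Fintype.card ι) := by
  rw [Matrix.det_apply]
  refine IsHomogeneous.sum _ _ _ fun τ _ => ?_
  have h : (∏ i, labelMatrix k e (τ i) i).IsHomogeneous (∑ _i : ι, 1) := by
    refine IsHomogeneous.prod _ _ _ fun i _ => ?_
    rw [labelMatrix_apply]
    cases e (τ i) i with
    | none => exact isHomogeneous_zero _ _ _
    | some s => exact isHomogeneous_X k s
  rw [Finset.sum_const, smul_eq_mul, mul_one, Finset.card_univ] at h
  rcases Int.units_eq_one_or (Equiv.Perm.sign τ) with h1 | h1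
  · rwa [h1, one_smul]
  · rw [h1, Units.neg_smul, one_smul]
    exact h.neg

/-- Euler's formula; characteristic zero makes the degree invertible. -/
theorem IsHomogeneous.mem_gradientIdeal [CharZero k] [Fintype σ] {f : MvPolynomial σ k} {n : ℕ}
    (hf : f.IsHomogeneous n) (hn : n ≠ 0) : f ∈ gradientIdeal f := by
  have h1 : n • f ∈ gradientIdeal f := by
    rw [← hf.sum_X_mul_pderiv]
    exact Ideal.sum_mem _ fun i _ => Ideal.mul_mem_left _ _ (Ideal.subset_span ⟨i, rfl⟩)
  have h2 : C ((n : k)⁻¹) * (n • f) = f := by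
    rw [nsmul_eq_mul, ← mul_assoc, ← map_natCast (C : k →+* MvPolynomial σ k), ← map_mul,
      inv_mul_cancel₀ (Nat.cast_ne_zero.mpr hn), map_one, one_mul]
  have h3 := Ideal.mul_mem_left _ (C ((n : k)⁻¹)) h1
  rwa [h2] at h3

/-- A partial matching of the labels shows that the determinant stays nonzero after killing the
variables that do not occur in the matching. -/
theorem IsSymmLabeling.det_notMem_span [Fintype ι] [DecidableEq ι] {e : ι → ι → Option σ}
    (he : IsSymmLabeling e) {τ : ι → ι} (hτ : Function.Involutive τ)
    (hsome : ∀ i, (e i (τ i)).isSome) {T : Set σ} (hT : ∀ t ∈ T, ∀ i, e i (τ i) ≠ some t) :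
    (labelMatrix k e).det ∉ Ideal.span (X '' T : Set (MvPolynomial σ k)) := by
  classical
  -- Specializing the matched variables to `1` and all others to `0` yields the permutation matrix
  -- of `τ`, with determinant `±1`.
  let g : σ → k := fun s => if ∃ i, e i (τ i) = some s then 1 else 0
  intro hmem
  have h0 : aeval g (labelMatrix k e).det = 0 := by
    have : Ideal.span (X '' T : Set (MvPolynomial σ k)) ≤ RingHom.ker (aeval g : _ →ₐ[k] k) := by
      rw [Ideal.span_le]
      rintro _ ⟨t, ht, rfl⟩
      change aeval g (X t) = 0
      rw [aeval_X]
      exact if_neg fun ⟨i, hi⟩ => hT t ht i hi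
    exact this hmem
  have h1 : (aeval g : _ →ₐ[k] k).mapMatrix (labelMatrix k e) = (hτ.toPerm).permMatrix k := by
    ext i j
    rw [AlgHom.mapMatrix_apply, Matrix.map_apply, labelMatrix_apply, Equiv.Perm.permMatrix,
      PEquiv.toMatrix_apply, Equiv.toPEquiv_apply, Function.Involutive.coe_toPerm]
    by_cases hij : τ i = j
    · subst hij
      obtain ⟨s, hs⟩ := Option.isSome_iff_exists.mp (hsome i)
      rw [hs, if_pos (Option.mem_some_iff.mpr rfl)]
      change aeval g (X s) = 1
      rw [aeval_X]
      exact if_pos ⟨i, hs⟩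
    · rw [if_neg (by simpa using hij)]
      cases h : e i j with
      | none => exact map_zero _
      | some s =>
        change aeval g (X s) = 0
        rw [aeval_X]
        refine if_neg ?_
        rintro ⟨l, hl⟩
        rcases he.inj hl h with ⟨rfl, h2⟩ | ⟨rfl, h2⟩
        · exact hij h2
        · exact hij (by rw [← h2, hτ])
  rw [AlgHom.map_det, h1, Matrix.det_permutation] at h0
  rcases Int.units_eq_one_or (Equiv.Perm.sign hτ.toPerm) with h2 | h2 <;> simp [h2] at h0

/-- A symmetric labeling of a square matrix of order `m` in which exactly the entries `(i, j)` with
`i + j + 2 ≤ m + s` (in zero-based indices) carry a label. -/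
structure IsStaircase (m s : ℕ) (e : Fin m → Fin m → Option σ) : Prop extends
    IsSymmLabeling e where
  isSome_iff : ∀ i j, (e i j).isSome ↔ (i : ℕ) + (j : ℕ) + 2 ≤ m + s

variable {m s n : ℕ}

theorem IsStaircase.exists_eq_some {e : Fin m → Fin m → Option σ} (he : IsStaircase m s e)
    {i j : Fin m} (h : (i : ℕ) + (j : ℕ) + 2 ≤ m + s) : ∃ t, e i j = some t :=
  Option.isSome_iff_exists.mp ((he.isSome_iff i j).mpr h)

theorem IsStaircase.eq_none_iff {e : Fin m → Fin m → Option σ} (he : IsStaircase m s e)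
    {i j : Fin m} : e i j = none ↔ m + s < (i : ℕ) + (j : ℕ) + 2 := by
  rw [← Option.not_isSome_iff_eq_none, he.isSome_iff, not_le]

/-- The involution of `Fin m` that fixes the first `c` elements and reverses the others. -/
def tailRev (m c : ℕ) (i : Fin m) : Fin m :=
  if h : (i : ℕ) < c then i else ⟨m - 1 + c - i, by omega⟩

theorem tailRev_val (m c : ℕ) (i : Fin m) :
    (tailRev m c i : ℕ) = if (i : ℕ) < c then (i : ℕ) else m - 1 + c - i := by
  unfold tailRev
  split_ifs <;> rfl

theorem tailRev_involutive (m c : ℕ) : Function.Involutive (tailRev m c) := by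
  intro i
  apply Fin.ext
  have := i.isLt
  simp only [tailRev_val]
  split_ifs <;> omega

/-- The reversed part of `tailRev m c` sits at zero-based positions with `i + j + 2 = m + c + 1`,
which lie in the staircase because `c + 1 ≤ s`. Varying `c` steers the matching away from prescribed
variables. -/
theorem IsStaircase.det_notMem_span {e : Fin m → Fin m → Option σ} (he : IsStaircase m s e)
    {c : ℕ} (hcs : c + 1 ≤ s) {T : Set σ}
    (hT : ∀ t ∈ T, ∃ a b, e a b = some t ∧ tailRev m c a ≠ b) :
    (labelMatrix k e).det ∉ Ideal.span (X '' T : Set (MvPolynomial σ k)) := by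
  refine he.toIsSymmLabeling.det_notMem_span (tailRev_involutive m c) (fun i => ?_) ?_
  · rw [he.isSome_iff, tailRev_val]
    have := i.isLt
    split_ifs <;> omega
  · intro t ht i hi
    obtain ⟨a, b, hab, hne⟩ := hT t ht
    rcases he.inj hi hab with ⟨rfl, h2⟩ | ⟨rfl, h2⟩
    · exact hne h2
    · exact hne (by rw [← h2, tailRev_involutive])

theorem IsStaircase.last_ne {e : Fin (n + 2) → Fin (n + 2) → Option σ}
    (he : IsStaircase (n + 2) s e) {t u : σ} (ht : e 0 (Fin.last _) = some t)
    (hu : e 1 (Fin.last _) = some u) : t ≠ u := by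
  rintro rfl
  rcases he.inj ht hu with ⟨h, -⟩ | ⟨h, -⟩ <;> simp [Fin.ext_iff] at h

/-- The rows `v` and `last` first, then the remaining rows in their order. -/
noncomputable def pivotTwoEquiv (v : Fin (n + 1)) : Fin 2 ⊕ Fin n ≃ Fin (n + 2) :=
  Equiv.ofBijective (Sum.elim ![v.castSucc, Fin.last _] fun i => (v.succAbove i).castSucc) (by
    rw [Fintype.bijective_iff_injective_and_card]
    refine ⟨?_, by simp [add_comm]⟩
    refine Function.Injective.sumElim ?_
      ((Fin.castSucc_injective _).comp Fin.succAbove_right_injective) ?_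
    · intro a b hab
      fin_cases a <;> fin_cases b <;> simp_all [Fin.castSucc_ne_last, (Fin.castSucc_ne_last _).symm]
    · intro a b
      fin_cases a
      · exact fun h => Fin.succAbove_ne v b (Fin.castSucc_injective _ h).symm
      · exact (Fin.castSucc_ne_last _).symm)

/-- Where the remaining matrix has a zero, both indices lie beyond the columns met by the last row.
The block adjugate has a zero in its first diagonal place, so every term of the Schur correction
contains a vanishing entry of the last row or column. As `v < s`, deleting `v` and `last` preserves
the staircase shape with the same `s`. -/
theorem IsStaircase.pivotReduction_two {e : Fin (n + 2) → Fin (n + 2) → Option σ}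
    (he : IsStaircase (n + 2) s e) (hs : s < n + 2) {v : Fin (n + 1)}
    (hvs : (v : ℕ) < s) {w : σ} (hw : e v.castSucc (Fin.last _) = some w) :
    ∃ e' : Fin n → Fin n → Option σ, IsStaircase n s e' ∧
      PivotReduction w (labelMatrix k e).det (labelMatrix k e').det := by
  set θ := pivotTwoEquiv v
  have hθ0 : θ (.inl 0) = v.castSucc := rfl
  have hθ1 : θ (.inl 1) = Fin.last _ := rfl
  have hθr : ∀ i : Fin n, θ (.inr i) = (v.succAbove i).castSucc := fun i => rfl
  have hθv : ∀ i : Fin n, ((θ (.inr i) : Fin (n + 2)) : ℕ) = if (i : ℕ) < v then (i : ℕ) else i + 1 := by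
    intro i
    rw [hθr, Fin.val_castSucc, Fin.succAbove]
    simp only [Fin.lt_def, Fin.val_castSucc]
    split_ifs <;> simp
  have heθ := he.toIsSymmLabeling.comp θ.injective
  have hsome : ∀ i j : Fin n, (e (θ (.inr i)) (θ (.inr j))).isSome ↔ (i : ℕ) + (j : ℕ) + 2 ≤ n + s := by
    intro i j
    rw [he.isSome_iff, hθv, hθv]
    have := i.isLt
    have := j.isLt
    split_ifs <;> omega
  refine ⟨fun i j => e (θ (.inr i)) (θ (.inr j)),
    { toIsSymmLabeling := heθ.comp Sum.inr_injective, isSome_iff := hsome }, ?_⟩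
  rw [← det_labelMatrix_comp_equiv e θ]
  have h01 : labelMatrix k (fun i j => e (θ i) (θ j)) (.inl 0) (.inl 1) = X w :=
    labelMatrix_of_some (e := fun i j => e (θ i) (θ j)) hw
  have h10 : labelMatrix k (fun i j => e (θ i) (θ j)) (.inl 1) (.inl 0) = X w :=
    labelMatrix_of_some (e := fun i j => e (θ i) (θ j)) ((he.symm _ _).trans hw)
  have h11 : labelMatrix k (fun i j => e (θ i) (θ j)) (.inl 1) (.inl 1) = 0 := by
    refine labelMatrix_of_none (e := fun i j => e (θ i) (θ j)) ?_
    change e (Fin.last _) (Fin.last _) = none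
    rw [he.eq_none_iff, Fin.val_last]
    omega
  refine pivotReduction_of_labeling heθ ⟨2, ?_⟩ fun i j hij => ?_
  · rw [Matrix.det_fin_two]
    simp only [Matrix.toBlocks₁₁, Matrix.of_apply, h01, h10, h11, mul_zero, zero_sub]
    rw [neg_dvd, sq]
  · rw [← Option.not_isSome_iff_eq_none, hsome] at hij
    have hlast : ∀ l l' : Fin n, n + s < (l : ℕ) + (l' : ℕ) + 2 →
        e (Fin.last _) (θ (.inr l)) = none := by
      intro l l' hl
      rw [he.eq_none_iff, hθv, Fin.val_last]
      have := l'.isLt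
      split_ifs <;> omega
    have hB : labelMatrix k (fun i j => e (θ i) (θ j)) (.inl 1) (.inr j) = 0 :=
      labelMatrix_of_none (e := fun i j => e (θ i) (θ j)) (hlast j i (by omega))
    have hC : labelMatrix k (fun i j => e (θ i) (θ j)) (.inr i) (.inl 1) = 0 :=
      labelMatrix_of_none (e := fun i j => e (θ i) (θ j))
        ((he.symm _ _).trans (hlast i j (by omega)))
    simp [Matrix.mul_apply, Fin.sum_univ_two, Matrix.adjugate_fin_two, Matrix.toBlocks₁₁,
      Matrix.toBlocks₁₂, Matrix.toBlocks₂₁, hB, hC, h11]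

/-- The row `v` first, then the remaining rows in their order. -/
noncomputable def pivotOneEquiv (v : Fin (n + 1)) : Fin 1 ⊕ Fin n ≃ Fin (n + 1) :=
  Equiv.ofBijective (Sum.elim (fun _ => v) v.succAbove) (by
    rw [Fintype.bijective_iff_injective_and_card]
    refine ⟨?_, by simp [add_comm]⟩
    exact Function.Injective.sumElim (Function.injective_of_subsingleton _)
      Fin.succAbove_right_injective fun _ b => (Fin.succAbove_ne v b).symm)

theorem IsStaircase.pivotReduction_one {e : Fin (n + 1) → Fin (n + 1) → Option σ}
    (he : IsStaircase (n + 1) s e) (hs : n + 1 ≤ s) {v : Fin (n + 1)} {w : σ}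
    (hw : e v v = some w) :
    ∃ e' : Fin n → Fin n → Option σ, IsStaircase n s e' ∧
      PivotReduction w (labelMatrix k e).det (labelMatrix k e').det := by
  set θ := pivotOneEquiv v
  have heθ := he.toIsSymmLabeling.comp θ.injective
  have hsome : ∀ i j, (e i j).isSome := by
    intro i j
    rw [he.isSome_iff]
    omega
  refine ⟨fun i j => e (θ (.inr i)) (θ (.inr j)),
    { toIsSymmLabeling := heθ.comp Sum.inr_injective
      isSome_iff := fun i j => iff_of_true (hsome _ _) (by omega) }, ?_⟩
  rw [← det_labelMatrix_comp_equiv e θ]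
  refine pivotReduction_of_labeling heθ ⟨1, ?_⟩ fun i j hij => ?_
  · rw [Matrix.det_fin_one, pow_one]
    have h00 : labelMatrix k (fun i j => e (θ i) (θ j)) (.inl 0) (.inl 0) = X w :=
      labelMatrix_of_some (e := fun i j => e (θ i) (θ j)) hw
    rw [Matrix.toBlocks₁₁, Matrix.of_apply, h00]
  · have := hsome (θ (.inr i)) (θ (.inr j))
    rw [show e (θ (.inr i)) (θ (.inr j)) = none from hij] at this
    exact absurd this Bool.false_ne_true

end Staircase

/-! ### The induction: primality, lower bounds and normality -/

section Determinant

open MvPolynomial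

variable {σ k : Type*} [Field k] {m s n : ℕ}

theorem det_labelMatrix_mem_gradientIdeal [CharZero k] [Finite σ] {e : Fin m → Fin m → Option σ}
    (hm : m ≠ 0) : (labelMatrix k e).det ∈ gradientIdeal (labelMatrix k e).det := by
  have := Fintype.ofFinite σ
  have h := isHomogeneous_det_labelMatrix (k := k) e
  rw [Fintype.card_fin] at h
  exact IsHomogeneous.mem_gradientIdeal h hm

theorem IsStaircase.not_X_dvd_det {e : Fin (n + 2) → Fin (n + 2) → Option σ}
    (he : IsStaircase (n + 2) s e) (hs : 2 ≤ s) {t : σ} (ht : e 0 (Fin.last _) = some t) :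
    ¬ X t ∣ (labelMatrix k e).det := by
  rw [X_dvd_iff_mem_span]
  refine he.det_notMem_span (c := 1) (by omega) ?_
  rintro _ rfl
  refine ⟨_, _, ht, fun h => ?_⟩
  have := congrArg Fin.val h
  rw [tailRev_val] at this
  simp at this

/-- Fixing the first two indices makes the matching avoid both `(0, last)` and `(1, last)`; this
costs `3 ≤ s`. -/
theorem IsStaircase.det_notMem_span_last {e : Fin (n + 2) → Fin (n + 2) → Option σ}
    (he : IsStaircase (n + 2) s e) (hn : 1 ≤ n) (hs : 3 ≤ s) {t u : σ}
    (ht : e 0 (Fin.last _) = some t) (hu : e 1 (Fin.last _) = some u) :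
    (labelMatrix k e).det ∉ Ideal.span (X '' {t, u} : Set (MvPolynomial σ k)) := by
  refine he.det_notMem_span (c := 2) (by omega) ?_
  rintro _ (rfl | rfl)
  · refine ⟨_, _, ht, fun h => ?_⟩
    have := congrArg Fin.val h
    rw [tailRev_val] at this
    simp at this
  · refine ⟨_, _, hu, fun h => ?_⟩
    have := congrArg Fin.val h
    rw [tailRev_val] at this
    simp at this
    omega

theorem IsStaircase.det_notMem_span_corner {e : Fin (n + 2) → Fin (n + 2) → Option σ}
    (he : IsStaircase (n + 2) s e) (hs : 1 ≤ s) {t u : σ}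
    (ht : e (Fin.last _) (Fin.last _) = some t) (hu : e 0 0 = some u) :
    (labelMatrix k e).det ∉ Ideal.span (X '' {t, u} : Set (MvPolynomial σ k)) := by
  refine he.det_notMem_span (c := 0) (by omega) ?_
  rintro _ (rfl | rfl)
  · refine ⟨_, _, ht, fun h => ?_⟩
    have := congrArg Fin.val h
    rw [tailRev_val] at this
    simp at this
  · refine ⟨_, _, hu, fun h => ?_⟩
    have := congrArg Fin.val h
    rw [tailRev_val] at this
    simp at this

/-- Irreducibility of the determinant, the lower bounds for the height of its gradient ideal and
normality of the hypersurface, for a staircase labeling. -/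
theorem IsStaircase.prime_det_and [CharZero k] [Finite σ] (hs : 2 ≤ s) :
    ∀ (m : ℕ) (_ : 1 ≤ m) (e : Fin m → Fin m → Option σ) (_ : IsStaircase m s e),
      Prime (labelMatrix k e).det ∧ 2 ≤ (gradientIdeal (labelMatrix k e).det).height ∧
        (3 ≤ s → 3 ≤ (gradientIdeal (labelMatrix k e).det).height ∧
          IsIntegrallyClosed (MvPolynomial σ k ⧸ Ideal.span {(labelMatrix k e).det})) := by
  intro m
  induction m using Nat.strong_induction_on with
  | _ m ih =>
  intro hm e he
  have hmem := det_labelMatrix_mem_gradientIdeal (k := k) (e := e) (by omega)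
  obtain rfl | ⟨n, rfl⟩ : m = 1 ∨ ∃ n, m = n + 2 := by
    rcases m with _ | _ | n
    · omega
    · exact .inl rfl
    · exact .inr ⟨n, rfl⟩
  · obtain ⟨t, ht⟩ := he.exists_eq_some (i := 0) (j := 0) (by simp; omega)
    have hdet : (labelMatrix k e).det = X t := by
      rw [Matrix.det_fin_one, labelMatrix_of_some ht]
    have htop : gradientIdeal (X t : MvPolynomial σ k) = ⊤ := by
      rw [Ideal.eq_top_iff_one]
      exact Ideal.subset_span ⟨t, pderiv_X_self t⟩
    rw [hdet, htop, Ideal.height_top]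
    exact ⟨X_prime, le_top, fun _ => ⟨le_top, isIntegrallyClosed_quotient_X t⟩⟩
  · by_cases hsm : s < n + 2
    · obtain ⟨t, ht⟩ := he.exists_eq_some (i := 0) (j := Fin.last _) (by simp; omega)
      obtain ⟨u, hu⟩ := he.exists_eq_some (i := 1) (j := Fin.last _) (by simp; omega)
      have htd := he.not_X_dvd_det (k := k) hs ht
      obtain ⟨e₁, he₁, h₁⟩ := he.pivotReduction_two (k := k) hsm (v := 0) (by simp; omega)
        (w := t) ht
      -- The bounds `2 ≤ s < n + 2` force `1 ≤ n`, so order zero never occurs.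
      obtain ⟨p₁, c₁, r₁⟩ := ih n (by omega) (by omega) e₁ he₁
      have hp := h₁.prime p₁ htd
      refine ⟨hp, h₁.two_le_height c₁ htd hmem, fun hs3 => ?_⟩
      have hv : ((⟨1, by omega⟩ : Fin (n + 1)) : ℕ) < s := by simp; omega
      obtain ⟨e₂, he₂, h₂⟩ := he.pivotReduction_two (k := k) hsm hv (w := u) hu
      obtain ⟨p₂, c₂, r₂⟩ := ih n (by omega) (by omega) e₂ he₂
      have htu := he.last_ne ht hu
      have hftu := he.det_notMem_span_last (k := k) (by omega) hs3 ht hu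
      have := (r₁ hs3).2
      have := (r₂ hs3).2
      exact ⟨three_le_height_gradientIdeal htu h₁ h₂ (r₁ hs3).1 (r₂ hs3).1 hftu hmem,
        isIntegrallyClosed_quotient_of_pivotReduction htu h₁ h₂ hp p₁ p₂ hftu⟩
    · rw [not_lt] at hsm
      obtain ⟨t, ht⟩ := he.exists_eq_some (i := Fin.last _) (j := Fin.last _) (by simp; omega)
      obtain ⟨u, hu⟩ := he.exists_eq_some (i := 0) (j := 0) (by simp; omega)
      have htu : t ≠ u := by
        rintro rfl
        rcases he.inj ht hu with ⟨h, -⟩ | ⟨h, -⟩ <;> simp [Fin.ext_iff] at h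
      have hftu := he.det_notMem_span_corner (k := k) (by omega) ht hu
      have htd : ¬ X t ∣ (labelMatrix k e).det := X_not_dvd_of_notMem_span (by simp) hftu
      obtain ⟨e₁, he₁, h₁⟩ := he.pivotReduction_one (k := k) hsm ht
      obtain ⟨e₂, he₂, h₂⟩ := he.pivotReduction_one (k := k) hsm hu
      obtain ⟨p₁, c₁, r₁⟩ := ih (n + 1) (by omega) (by omega) e₁ he₁
      obtain ⟨p₂, c₂, r₂⟩ := ih (n + 1) (by omega) (by omega) e₂ he₂
      have hp := h₁.prime p₁ htd
      refine ⟨hp, h₁.two_le_height c₁ htd hmem, fun hs3 => ?_⟩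
      have := (r₁ hs3).2
      have := (r₂ hs3).2
      exact ⟨three_le_height_gradientIdeal htu h₁ h₂ (r₁ hs3).1 (r₂ hs3).1 hftu hmem,
        isIntegrallyClosed_quotient_of_pivotReduction htu h₁ h₂ hp p₁ p₂ hftu⟩

end Determinant

/-! ### Upper bounds and failure of normality -/

section UpperBounds

open MvPolynomial

variable {σ k : Type*} [Field k] {m s n : ℕ}

theorem Derivation.apply_mem_of_mem_mul {A : Type*} [CommRing A] [Algebra k A]
    (D : Derivation k A A) {I : Ideal A} {y : A} (hy : y ∈ I * I) : D y ∈ I := by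
  induction hy using Submodule.mul_induction_on' with
  | mem_mul_mem a ha b hb =>
    rw [D.leibniz]
    exact I.add_mem (I.mul_mem_right _ ha) (I.mul_mem_right _ hb)
  | add a _ b _ ha hb =>
    rw [map_add]
    exact I.add_mem ha hb

theorem gradientIdeal_le_of_mem_mul {f : MvPolynomial σ k} {I : Ideal (MvPolynomial σ k)}
    (hf : f ∈ I * I) : gradientIdeal f ≤ I := by
  rw [gradientIdeal, Ideal.span_le]
  rintro _ ⟨v, rfl⟩
  exact (pderiv v).apply_mem_of_mem_mul hf

/-- A determinant lies in the square of every ideal containing a row and a column that cross in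
zero. -/
theorem det_mem_mul_of_cross {A ι : Type*} [CommRing A] [Fintype ι] [DecidableEq ι]
    {M : Matrix ι ι A} {I : Ideal A} (a : ι) (hrow : ∀ j, M a j ∈ I) (hcol : ∀ i, M i a ∈ I)
    (haa : M a a = 0) : M.det ∈ I * I := by
  rw [Matrix.det_apply]
  refine Ideal.sum_mem _ fun τ _ => ?_
  have h : ∏ i, M (τ i) i ∈ I * I := by
    -- A permutation fixing `a` picks the zero at the crossing; any other picks one entry from row
    -- `a` and a different one from column `a`.
    by_cases hτ : τ a = a
    · rw [Finset.prod_eq_zero (Finset.mem_univ a) (by rw [hτ, haa])]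
      exact Ideal.zero_mem _
    · have hb : τ.symm a ∈ Finset.univ.erase a := by
        rw [Finset.mem_erase]
        exact ⟨fun h => hτ ((Equiv.symm_apply_eq _).mp h).symm, Finset.mem_univ _⟩
      rw [← Finset.mul_prod_erase _ _ (Finset.mem_univ a), ← Finset.mul_prod_erase _ _ hb,
        ← mul_assoc]
      refine Ideal.mul_mem_right _ _ (Ideal.mul_mem_mul (hcol _) ?_)
      rw [Equiv.apply_symm_apply]
      exact hrow _
  rcases Int.units_eq_one_or (Equiv.Perm.sign τ) with h1 | h1
  · rwa [h1, one_smul]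
  · rw [h1, Units.neg_smul, one_smul]
    exact Ideal.neg_mem_iff _ |>.mpr h

theorem IsStaircase.det_mem_mul {e : Fin (n + 2) → Fin (n + 2) → Option σ}
    (he : IsStaircase (n + 2) 2 e) (hn : 1 ≤ n) {t u : σ}
    (ht : e 0 (Fin.last _) = some t) (hu : e 1 (Fin.last _) = some u) :
    (labelMatrix k e).det ∈ Ideal.span {X t, X u} * Ideal.span {(X t : MvPolynomial σ k), X u} := by
  have hcol : ∀ i, labelMatrix k e i (Fin.last _) ∈ Ideal.span {(X t : MvPolynomial σ k), X u} := by
    intro i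
    by_cases h0 : i = 0
    · rw [h0, labelMatrix_of_some ht]
      exact Ideal.subset_span (by simp)
    by_cases h1 : i = 1
    · rw [h1, labelMatrix_of_some hu]
      exact Ideal.subset_span (by simp)
    · rw [labelMatrix_of_none]
      · exact Ideal.zero_mem _
      · rw [he.eq_none_iff, Fin.val_last]
        simp only [Fin.ext_iff, Fin.val_zero, Fin.val_one] at h0 h1
        omega
  refine det_mem_mul_of_cross (Fin.last _) (fun j => ?_) hcol ?_
  · rw [← he.transpose_labelMatrix]
    exact hcol j
  · rw [labelMatrix_of_none]
    rw [he.eq_none_iff, Fin.val_last]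
    omega

theorem IsStaircase.height_le_two [Finite σ] {e : Fin (n + 2) → Fin (n + 2) → Option σ}
    (he : IsStaircase (n + 2) 2 e) (hn : 1 ≤ n) :
    (gradientIdeal (labelMatrix k e).det).height ≤ 2 := by
  classical
  obtain ⟨t, ht⟩ := he.exists_eq_some (i := 0) (j := Fin.last _) (by simp)
  obtain ⟨u, hu⟩ := he.exists_eq_some (i := 1) (j := Fin.last _) (by simp; omega)
  refine (Ideal.height_mono (gradientIdeal_le_of_mem_mul (he.det_mem_mul hn ht hu))).trans ?_
  have hp : (Ideal.span {(X t : MvPolynomial σ k), X u}).IsPrime := by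
    have := isPrime_span_X_image (k := k) {t, u}
    rwa [Set.image_pair] at this
  have h := Ideal.height_le_card_of_mem_minimalPrimes_span_finset
    (p := Ideal.span {(X t : MvPolynomial σ k), X u}) (s := {X t, X u})
    (by
      rw [Finset.coe_pair, Ideal.minimalPrimes_eq_subsingleton_self]
      exact rfl)
  exact h.trans (by exact_mod_cast Finset.card_le_two)

theorem det_smul_sub_adjugate {A κ μ : Type*} [CommRing A] [Fintype κ] [DecidableEq κ]
    [Fintype μ] [DecidableEq μ] (P : Matrix κ κ A) (B : Matrix κ μ A) (C : Matrix μ κ A)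
    (D : Matrix μ μ A) :
    (Matrix.fromBlocks P B C D).det * P.det ^ Fintype.card μ =
      P.det * (P.det • D - C * P.adjugate * B).det := by
  have h : Matrix.fromBlocks P B C D *
      Matrix.fromBlocks 1 (-(P.adjugate * B)) 0 (P.det • (1 : Matrix μ μ A)) =
        Matrix.fromBlocks P 0 C (P.det • D - C * P.adjugate * B) := by
    rw [Matrix.fromBlocks_multiply]
    congr 1
    · simp
    · rw [Matrix.mul_neg, ← Matrix.mul_assoc, Matrix.mul_adjugate, Matrix.smul_mul, Matrix.one_mul,
        Matrix.mul_smul, Matrix.mul_one, neg_add_cancel]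
    · simp
    · rw [Matrix.mul_neg, ← Matrix.mul_assoc, Matrix.mul_smul, Matrix.mul_one]
      abel
  have h' := congrArg Matrix.det h
  rwa [Matrix.det_mul, Matrix.det_fromBlocks_zero₂₁, Matrix.det_one, one_mul, Matrix.det_smul,
    Matrix.det_one, mul_one, Matrix.det_fromBlocks_zero₁₂] at h'

/-- With `A` the leading block of order `n` and `E` the scaled Schur complement, `A.det * f = E.det`
is quadratic in the three entries of the symmetric matrix `E`. Hence `f` is singular along any
component of `E = 0` not contained in `A.det = 0`, and Krull's theorem bounds its codimension by
three. -/
theorem IsStaircase.height_le_three [Finite σ] {e : Fin (n + 2) → Fin (n + 2) → Option σ}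
    (he : IsStaircase (n + 2) s e) (hs : 1 ≤ s) :
    (gradientIdeal (labelMatrix k e).det).height ≤ 3 := by
  classical
  let θ : Fin n ⊕ Fin 2 ≃ Fin (n + 2) := finSumFinEquiv
  have heθ := he.toIsSymmLabeling.comp θ.injective
  rw [← det_labelMatrix_comp_equiv e θ]
  set M := labelMatrix k fun i j => e (θ i) (θ j)
  set A := M.toBlocks₁₁
  set B := M.toBlocks₁₂
  set C := M.toBlocks₂₁
  set D := M.toBlocks₂₂
  set E := A.det • D - C * A.adjugate * B with hE
  have hMt : M.transpose = M := heθ.transpose_labelMatrix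
  have hAt : A.transpose = A := by
    ext1 i j
    exact congrFun (congrFun hMt (.inl i)) (.inl j)
  have hBt : B.transpose = C := by
    ext1 i j
    exact congrFun (congrFun hMt (.inr i)) (.inl j)
  have hCt : C.transpose = B := by rw [← hBt, Matrix.transpose_transpose]
  have hDt : D.transpose = D := by
    ext1 i j
    exact congrFun (congrFun hMt (.inr i)) (.inr j)
  have hE01 : E 1 0 = E 0 1 := by
    have : E.transpose = E := by
      rw [hE, Matrix.transpose_sub, Matrix.transpose_smul, Matrix.transpose_mul,
        Matrix.transpose_mul, Matrix.adjugate_transpose, hAt, hBt, hCt, hDt, Matrix.mul_assoc]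
    exact congrFun (congrFun this 0) 1
  -- Setting the last two rows and columns to zero kills `E` but not `A.det`, whose antidiagonal
  -- survives. A minimal prime over the entries of `E` inside this coordinate ideal therefore avoids
  -- `A.det`.
  let T : Set σ := {t | ∃ (a : Fin n ⊕ Fin 2) (b : Fin 2), e (θ a) (θ (.inr b)) = some t}
  have hTB : ∀ a b, M a (.inr b) ∈ Ideal.span (X '' T : Set (MvPolynomial σ k)) := by
    intro a b
    change (e (θ a) (θ (.inr b))).elim 0 X ∈ _
    cases h : e (θ a) (θ (.inr b)) with
    | none => exact Ideal.zero_mem _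
    | some t => exact X_mem_span_X_image_iff.mpr ⟨a, b, h⟩
  have hET : ∀ i j, E i j ∈ Ideal.span (X '' T : Set (MvPolynomial σ k)) := by
    intro i j
    rw [hE, Matrix.sub_apply, Matrix.smul_apply, smul_eq_mul, Matrix.mul_apply]
    exact Ideal.sub_mem _ (Ideal.mul_mem_left _ _ (hTB (.inr i) j))
      (Ideal.sum_mem _ fun a _ => Ideal.mul_mem_left _ _ (hTB (.inl a) j))
  have hθv : ∀ i : Fin n, ((θ (.inl i) : Fin (n + 2)) : ℕ) = i := fun i => by simp [θ]
  have hAT : A.det ∉ Ideal.span (X '' T : Set (MvPolynomial σ k)) := by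
    refine (heθ.comp Sum.inl_injective).det_notMem_span (tailRev_involutive n 0) (fun i => ?_) ?_
    · rw [he.isSome_iff, hθv, hθv, tailRev_val]
      have := i.isLt
      split_ifs <;> omega
    · rintro t ⟨a, b, hab⟩ i hi
      have h1 := heθ.inj hi hab
      simp at h1
  have hA0 : A.det ≠ 0 := fun h => hAT (h ▸ Ideal.zero_mem _)
  have hdet : A.det * M.det = E.det := by
    have h1 := det_smul_sub_adjugate A B C D
    rw [Matrix.fromBlocks_toBlocks, Fintype.card_fin] at h1
    apply mul_left_cancel₀ hA0
    rw [← h1]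
    ring
  set S : Finset (MvPolynomial σ k) := {E 0 0, E 0 1, E 1 1} with hS
  have hp := isPrime_span_X_image (k := k) T
  obtain ⟨P, hPmin, hPT⟩ := Ideal.exists_minimalPrimes_le (I := Ideal.span (S : Set _))
    (J := Ideal.span (X '' T : Set (MvPolynomial σ k))) (by
      rw [Ideal.span_le]
      intro y hy
      simp only [hS, Finset.coe_insert, Finset.coe_singleton, Set.mem_insert_iff,
        Set.mem_singleton_iff] at hy
      rcases hy with rfl | rfl | rfl <;> exact hET _ _)
  have hPprime : P.IsPrime := hPmin.1.1
  have hAP : A.det ∉ P := fun h => hAT (hPT h)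
  have hPh : P.height ≤ 3 := (Ideal.height_le_card_of_mem_minimalPrimes_span_finset hPmin).trans
    (by exact_mod_cast Finset.card_le_three)
  refine le_trans (Ideal.height_mono ?_) hPh
  have hSP : ∀ y ∈ S, y ∈ P := fun y hy => hPmin.1.2 (Ideal.subset_span hy)
  have hEP : E.det ∈ P * P := by
    rw [Matrix.det_fin_two, hE01]
    exact Ideal.sub_mem _
      (Ideal.mul_mem_mul (hSP _ (by simp [hS])) (hSP _ (by simp [hS])))
      (Ideal.mul_mem_mul (hSP _ (by simp [hS])) (hSP _ (by simp [hS])))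
  rw [← hdet] at hEP
  have hMP : M.det ∈ P := (hPprime.mem_or_mem (Ideal.mul_le_left hEP)).resolve_left hAP
  rw [gradientIdeal, Ideal.span_le]
  rintro _ ⟨v, rfl⟩
  -- By Leibniz, differentiating `A.det * f ∈ P * P` leaves `A.det * pderiv v f` in `P`, since `f ∈
  -- P`.
  have h1 := (pderiv v).apply_mem_of_mem_mul hEP
  rw [Derivation.leibniz, smul_eq_mul, smul_eq_mul,
    Ideal.add_mem_iff_left _ (Ideal.mul_mem_right _ _ hMP)] at h1
  exact (hPprime.mem_or_mem h1).resolve_left hAP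

/-- A hypersurface that is singular along `t = u = 0`, where `t` and `u` are variables, is not
normal. -/
theorem not_isIntegrallyClosed_of_mem_mul {t u : σ} (htu : t ≠ u) {f : MvPolynomial σ k}
    (hf : Prime f) (hu : ¬ X u ∣ f) (hfI : f ∈ Ideal.span {X t, X u} * Ideal.span {X t, X u}) :
    ¬ IsIntegrallyClosed (MvPolynomial σ k ⧸ Ideal.span {f}) := by
  have := isDomain_quotient_span_singleton hf
  obtain ⟨α, β, γ, hαβγ⟩ : ∃ α β γ, f = α * X t ^ 2 + β * (X t * X u) + γ * X u ^ 2 := by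
    rw [Ideal.span_pair_mul_span_pair] at hfI
    simp only [Ideal.mem_span_insert, Ideal.mem_span_singleton'] at hfI
    obtain ⟨a, _, ⟨b, _, ⟨c, _, ⟨d, rfl⟩, rfl⟩, rfl⟩, rfl⟩ := hfI
    exact ⟨a, b + c, d, by ring⟩
  intro h
  set q := Ideal.Quotient.mk (Ideal.span {f})
  have hq : q f = 0 := Ideal.Quotient.eq_zero_iff_dvd _ _ |>.mpr dvd_rfl
  have hu0 : q (X u) ≠ 0 := by
    rw [Ne, Ideal.Quotient.eq_zero_iff_dvd]
    exact fun h => hu (hf.irreducible.dvd_symm X_prime.irreducible h)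
  -- The fraction `α t / u` is a root of `p`, since `(α t)² + β u (α t) + α γ u² = α f`.
  let p : Polynomial (MvPolynomial σ k ⧸ Ideal.span {f}) :=
    Polynomial.X ^ 2 + Polynomial.C (q β) * Polynomial.X + Polynomial.C (q (α * γ))
  have hpd : p.natDegree = 2 := by
    simp only [p]
    compute_degree!
  have hp : p.Monic := by
    simp only [p]
    monicity!
  have hroot : (p.scaleRoots (q (X u))).eval (q (α * X t)) = 0 := by
    rw [Polynomial.eval_eq_sum_range, Polynomial.natDegree_scaleRoots, hpd]
    have c0 : p.coeff 0 = q (α * γ) := by simp [p]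
    have c1 : p.coeff 1 = q β := by simp [p]
    have c2 : p.coeff 2 = 1 := by simp [p]
    simp only [Finset.sum_range_succ, Finset.sum_range_zero, Polynomial.coeff_scaleRoots, hpd, c0,
      c1, c2]
    have h1 : α * γ * X u ^ 2 + β * X u * (α * X t) + (α * X t) ^ 2 = α * f := by
      rw [hαβγ]
      ring
    have h2 := congrArg q h1
    rw [map_mul q α f, hq, mul_zero] at h2
    refine Eq.trans ?_ h2
    simp only [map_mul, map_add, map_pow]
    ring
  obtain ⟨y, hy⟩ := isIntegrallyClosed_iff_scaleRoots.mp h p _ _ hp hu0 hroot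
  obtain ⟨y, rfl⟩ := Ideal.Quotient.mk_surjective y
  rw [← map_mul, Ideal.Quotient.eq, Ideal.mem_span_singleton] at hy
  obtain ⟨c, hc⟩ := hy
  -- If `α t / u` were regular, then `α t` would lie in `(f, u)`. Setting `u = 0` gives `π α * t = π
  -- α * t² * π c`, making `t` a unit.
  set π := killVars k ({u} : Set σ)
  have hπu : π (X u) = 0 := killVars_X_of_mem rfl
  have hπt : π (X t) = X t := killVars_X_of_notMem htu
  have hπf : π f = π α * X t ^ 2 := by
    rw [hαβγ]
    simp only [map_add, map_mul, map_pow, hπu, hπt]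
    ring
  have h1 := congrArg π hc
  rw [map_sub, map_mul, map_mul, map_mul, hπu, hπt, hπf, zero_mul, sub_zero] at h1
  have hf0 : π f ≠ 0 := fun h0 => hu (X_dvd_iff_mem_span.mpr ((mem_span_X_image_iff _ _).mpr h0))
  rw [hπf] at hf0
  have h2 : π α * X t ≠ 0 := by
    intro h0
    apply hf0
    rw [sq, ← mul_assoc, h0, zero_mul]
  apply (X_prime (R := k) (i := t)).not_isUnit
  refine .of_mul_eq_one (π c) (mul_left_cancel₀ h2 ?_)
  rw [mul_one]
  refine Eq.trans ?_ h1.symm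
  ring

end UpperBounds

/-! ### The matrix `S(r)` as a staircase with `s = m - r` -/

section SparseMatrix

open MvPolynomial

/-- The labeling of the entries of the sparse symmetric matrix by its variables. -/
def sparseLabel (m r : ℕ) (i j : Fin m) : Option (SparseVar m r) :=
  if h : ((i : ℕ) + 1) + ((j : ℕ) + 1) + r ≤ 2 * m then
    some ⟨(min i j, max i j), sparseVar_mem h⟩
  else none

theorem isStaircase_sparseLabel {m r : ℕ} (hrm : r ≤ m) :
    IsStaircase m (m - r) (sparseLabel m r) where
  symm i j := by
    unfold sparseLabel
    by_cases h : ((i : ℕ) + 1) + ((j : ℕ) + 1) + r ≤ 2 * m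
    · rw [dif_pos h, dif_pos (by omega)]
      simp only [min_comm, max_comm]
    · rw [dif_neg h, dif_neg (by omega)]
  inj := by
    intro i j i' j' s h h'
    unfold sparseLabel at h h'
    split_ifs at h h' with h1 h2
    rw [← h', Option.some_inj, Subtype.mk.injEq, Prod.mk.injEq] at h
    obtain ⟨h3, h4⟩ := h
    rcases le_total i j with h5 | h5 <;> rcases le_total i' j' with h6 | h6 <;>
      simp only [min_eq_left, min_eq_right, max_eq_left, max_eq_right, h5, h6] at h3 h4 <;>
      simp [h3, h4]
  isSome_iff i j := by
    unfold sparseLabel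
    split_ifs with h
    · exact iff_of_true rfl (by omega)
    · exact iff_of_false Bool.false_ne_true (by omega)

theorem sparseDet_eq (k : Type*) [Field k] (m r : ℕ) :
    sparseDet k m r = (labelMatrix k (sparseLabel m r)).det := by
  unfold sparseDet
  congr 1
  ext1 i j
  rw [labelMatrix_apply, sparseMatrix, Matrix.of_apply, sparseLabel]
  split_ifs <;> rfl

end SparseMatrix

theorem proposition3p3 {k : Type*} [Field k] [CharZero k] (m r : ℕ)
    (hr : 1 ≤ r) (hrm : r + 2 ≤ m) :
    Irreducible (sparseDet k m r) ∧
    (gradientIdeal (sparseDet k m r)).height = (if m - r = 2 then 2 else 3) ∧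
    ((IsDomain (MvPolynomial (SparseVar m r) k ⧸ Ideal.span {sparseDet k m r}) ∧
        IsIntegrallyClosed (MvPolynomial (SparseVar m r) k ⧸ Ideal.span {sparseDet k m r})) ↔
      3 ≤ m - r) := by
  have he := isStaircase_sparseLabel (m := m) (r := r) (by omega)
  obtain ⟨n, rfl⟩ : ∃ n, m = n + 2 := ⟨m - 2, by omega⟩
  rw [sparseDet_eq]
  obtain ⟨hp, h2, h3⟩ := IsStaircase.prime_det_and (k := k) (by omega) _ (by omega) _ he
  refine ⟨hp.irreducible, ?_, ?_⟩
  · split_ifs with hs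
    · rw [hs] at he
      exact le_antisymm (he.height_le_two (by omega)) h2
    · exact le_antisymm (he.height_le_three (by omega)) (h3 (by omega)).1
  · constructor
    · rintro ⟨-, hic⟩
      by_contra hs
      have hs2 : n + 2 - r = 2 := by omega
      rw [hs2] at he
      obtain ⟨t, ht⟩ := he.exists_eq_some (i := 0) (j := Fin.last _) (by simp)
      obtain ⟨u, hu⟩ := he.exists_eq_some (i := 1) (j := Fin.last _) (by simp; omega)
      refine not_isIntegrallyClosed_of_mem_mul (he.last_ne ht hu) hp ?_
        (he.det_mem_mul (by omega) ht hu) hic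
      rw [X_dvd_iff_mem_span]
      -- The full antidiagonal pairs `last` with `0`, so it avoids `u` at `(1, last)`; with `c = 1`
      -- the matching would use `u`.
      refine he.det_notMem_span (c := 0) (by omega) ?_
      rintro _ rfl
      refine ⟨_, _, hu, fun h => ?_⟩
      have := congrArg Fin.val h
      rw [tailRev_val] at this
      simp at this
    · exact fun hs => ⟨isDomain_quotient_span_singleton hp, (h3 hs).2⟩
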